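/- A discounted MDP consists of finite state and action sets, a discount factor $\gamma\in(0,1)$, a deterministic reward $r(s,a)\in[0,1]$ and transition probabilities $P(s'\mid s,a)$. An algorithm is a (possibly randomized) history-dependent policy $\pi$, which chooses $a_t$ from $s_1,a_1,\dots,s_{t-1},a_{t-1},s_t$. Let $V^\pi_t(s_t)=\mathbb E\big[\sum_{i\ge 0}\gamma^i r(s_{t+i},a_{t+i})\,\big|\,s_1,a_1,\dots,s_{t-1},a_{t-1},s_t\big]$, $V^*(s)=\sup_\pi V^\pi_1(s)$ and $\mathrm{Regret}(T)=\sum_{t=1}^T[V^*(s_t)-V^\pi_t(s_t)]$. For integers $S,T\ge 1$ let $L=\log\big(300S^4T^2/(1-\gamma)\big)\log(10ST)$. Suppose $2/3\le\gamma<1$, $A\ge 30$ and $T\ge 100SAL/(1-\gamma)^4$. Put $K=T/(10S)$ and $\epsilon=\frac1{24}\sqrt{A(1-\gamma)/K}$. For $a^*=(a^*_1,\dots,a^*_S)\in\{1,\dots,A\}^S$ let $M_{a^*}$ be the discounted MDP with discount factor $\gamma$, the $A$ actions $1,\dots,A$ and the $2S$ states $s_{i,0},s_{i,1}$ $(1\le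 i\le S)$, rewards $r(s_{i,0},a)=0$, $r(s_{i,1},a)=1$, and transition probabilities $$P(s_{i,1}\mid s_{i,0},a)=1-\gamma+\epsilon\mathbf 1_{a=a^*_i},\quad P(s_{i,0}\mid s_{i,0},a)=\gamma-\epsilon\mathbf 1_{a=a^*_i},\quad P(s_{i,1}\mid s_{i,1},a)=\gamma,\quad P(s_{i+1,0}\mid s_{i,1},a)=1-\gamma,$$ where $s_{S+1,0}=s_{1,0}$. Then for every algorithm $\pi$ and every initial state $s_1$ there is $a^*\in\{1,\dots,A\}^S$ such that in $M_{a^*}$ $$\mathbb E[\mathrm{Regret}(T)]\ \ge\ \frac{\sqrt{SAT}}{10000(1-\gamma)^{1.5}}-\frac{4\sqrt{STL}}{(1-\gamma)^{1.5}}-\frac{8S}{(1-\gamma)^2}.$$ -/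

import Mathlib

open MeasureTheory ProbabilityTheory

noncomputable section

/-- A discounted Markov decision process with state space `𝒮` and action space `𝒜`, a
deterministic reward function with values in `[0,1]` and discount factor in `(0,1)`. -/
structure DiscountedMDP (𝒮 𝒜 : Type) where
  discount : ℝ
  discount_pos : 0 < discount
  discount_lt_one : discount < 1
  reward : 𝒮 → 𝒜 → ℝ
  reward_mem : ∀ s a, reward s a ∈ Set.Icc (0 : ℝ) 1
  trans : 𝒮 → 𝒜 → PMF 𝒮

/-- A (possibly randomized) non-stationary policy, that is, an online learning algorithm: from the
`n` state-action pairs seen so far and the current state it draws the next action. A deterministic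
policy is the case where all these distributions are point masses. Times start at `0`. -/
abbrev Policy (𝒮 𝒜 : Type) : Type :=
  (n : ℕ) → (Fin n → 𝒮 × 𝒜) → 𝒮 → PMF 𝒜

namespace DiscountedMDP

variable {𝒮 𝒜 : Type} [Fintype 𝒮] [Fintype 𝒜] [MeasurableSpace 𝒮] [MeasurableSpace 𝒜]
  [MeasurableSingletonClass 𝒮] [MeasurableSingletonClass 𝒜]

/-- Given the state-action pairs at times `0, …, n`, the law of the pair at time `n + 1`: the next
state is drawn from the transition probabilities, the next action from the policy. -/
def stepKernel (M : DiscountedMDP 𝒮 𝒜) (π : Policy 𝒮 𝒜) (n : ℕ) :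
    Kernel ((i : Finset.Iic n) → 𝒮 × 𝒜) (𝒮 × 𝒜) :=
  Kernel.ofFunOfCountable fun h =>
    ((M.trans (h ⟨n, Finset.mem_Iic.2 le_rfl⟩).1 (h ⟨n, Finset.mem_Iic.2 le_rfl⟩).2).bind fun s' =>
      (π (n + 1) (fun i => h ⟨i, Finset.mem_Iic.2 (Nat.le_of_lt_succ i.isLt)⟩) s').map
        fun a' => (s', a')).toMeasure

instance (M : DiscountedMDP 𝒮 𝒜) (π : Policy 𝒮 𝒜) (n : ℕ) :
    IsMarkovKernel (M.stepKernel π n) :=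
  ⟨fun h => by
    show IsProbabilityMeasure (PMF.toMeasure _)
    infer_instance⟩

/-- The history up to time `n` made of the `n` pairs `h` followed by the pair `x`. -/
def extendHistory {X : Type} (n : ℕ) (h : Fin n → X) (x : X) : (i : Finset.Iic n) → X :=
  fun i => if hi : (i : ℕ) < n then h ⟨i, hi⟩ else x

/-- The law of the whole trajectory `(s₀, a₀), (s₁, a₁), …` under the policy `π`, given that the
first `n` pairs are `h` and that the state at time `n` is `s`. -/
def lawGiven (M : DiscountedMDP 𝒮 𝒜) (π : Policy 𝒮 𝒜) (n : ℕ) (h : Fin n → 𝒮 × 𝒜) (s : 𝒮) :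
    Measure (ℕ → 𝒮 × 𝒜) :=
  ∑ a : 𝒜, π n h s a •
    Kernel.traj (X := fun _ => 𝒮 × 𝒜) (M.stepKernel π) n (extendHistory n h (s, a))

/-- The law of the trajectory under `π` started in the state `s`. -/
def law (M : DiscountedMDP 𝒮 𝒜) (π : Policy 𝒮 𝒜) (s : 𝒮) : Measure (ℕ → 𝒮 × 𝒜) :=
  M.lawGiven π 0 Fin.elim0 s

/-- The value function of `π` at time `n`: the expected discounted sum of the rewards from time `n`
on, given the past `h` and the current state `s`. -/
def value (M : DiscountedMDP 𝒮 𝒜) (π : Policy 𝒮 𝒜) (n : ℕ) (h : Fin n → 𝒮 × 𝒜) (s : 𝒮) : ℝ :=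
  ∫ ω, ∑' i : ℕ, M.discount ^ i * M.reward (ω (n + i)).1 (ω (n + i)).2 ∂(M.lawGiven π n h s)

/-- The optimal value function. -/
def optValue (M : DiscountedMDP 𝒮 𝒜) (s : 𝒮) : ℝ :=
  ⨆ π : Policy 𝒮 𝒜, M.value π 0 Fin.elim0 s

/-- The regret of `π` over the first `T` steps of the trajectory `ω`. -/
def regret (M : DiscountedMDP 𝒮 𝒜) (π : Policy 𝒮 𝒜) (T : ℕ) (ω : ℕ → 𝒮 × 𝒜) : ℝ :=
  ∑ t ∈ Finset.range T, (M.optValue (ω t).1 - M.value π t (fun i => ω i) (ω t).1)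

/-- The expected regret of `π` over the first `T` steps, started in the state `s`. -/
def expectedRegret (M : DiscountedMDP 𝒮 𝒜) (π : Policy 𝒮 𝒜) (s : 𝒮) (T : ℕ) : ℝ :=
  ∫ ω, M.regret π T ω ∂(M.law π s)

/-- `M` is the ring of `S` two-state MDPs with states `(i, 0)` and `(i, 1)`, optimal actions
`aStar i`, discount factor `γ` and gap `ε`. The addition `i + 1` is cyclic. -/
structure IsHardRing {S A : ℕ} [NeZero S] (M : DiscountedMDP (Fin S × Fin 2) (Fin A))
    (γ ε : ℝ) (aStar : Fin S → Fin A) : Prop where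
  discount_eq : M.discount = γ
  reward_zero : ∀ i a, M.reward (i, 0) a = 0
  reward_one : ∀ i a, M.reward (i, 1) a = 1
  trans_zero_one : ∀ i a,
    (M.trans (i, 0) a (i, 1)).toReal = 1 - γ + if a = aStar i then ε else 0
  trans_zero_zero : ∀ i a,
    (M.trans (i, 0) a (i, 0)).toReal = γ - if a = aStar i then ε else 0
  trans_one_one : ∀ i a, (M.trans (i, 1) a (i, 1)).toReal = γ
  trans_one_next : ∀ i a, (M.trans (i, 1) a (i + 1, 0)).toReal = 1 - γ

end DiscountedMDP

/-- The logarithmic factor `L = log (300 S⁴ T² / (1 - γ)) log (10 S T)`. -/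
def logFactor (S T : ℕ) (γ : ℝ) : ℝ :=
  Real.log (300 * (S : ℝ) ^ 4 * (T : ℝ) ^ 2 / (1 - γ)) * Real.log (10 * S * T)

end

/-!
The proof compares policies with the optimal one through suboptimality gaps, and then bounds the
number of suboptimal actions from below.

*From regret to counting.* If `v` solves the Bellman equation of the ring up to a loss `gap s a`, the
value of a policy falls short of `v` by the expected discounted sum of the gaps it incurs
(`DiscountedMDP.value_le`), and `v` is attained, so that `v ≤ V*` (`DiscountedMDP.le_optValue`). By
the tower property, summing over the first `T` steps charges each gap about `1 / (1 - γ)` times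
(`DiscountedMDP.expectedRegret_ge`). On the ring the gap is a constant of order `ε / (1 - γ)` for a
wrong action in a node `(i, 0)` and zero elsewhere. It remains to show that some choice of optimal
actions forces at least `T / 50` wrong actions in expectation
(`DiscountedMDP.exists_suboptimal_ge`).

*Visits.* Along a trajectory all `2 S` nodes are left equally often up to one departure, and the
number of departures from a node differs from the sum of its departure probabilities by a martingale
whose variance is at most of the order of `1 - γ` per visit. Hence every node takes an equal share of
the time up to lower order terms, which yields an upper bound for the expected visits of each node
and a lower bound for the visits truncated at `K = T / (10 S)`
(`DiscountedMDP.integral_visits_le`, `DiscountedMDP.integral_sum_min_visits_ge`).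

*Indistinguishability.* Compare the ring with optimal action `a` in `(i, 0)` with the ring without
any favoured action there. In the latter most actions are played at most `m = 50 K / A` times, by
Markov's inequality. With `L` the likelihood ratio of the two laws, `L + 1 / L ≥ 2`, and `1 / L`
times a constant to the power of the number of pulls is the likelihood ratio of yet another ring; so
most actions `a` are also played at most `m` times when they are the optimal ones
(`DiscountedMDP.integral_fewPulls_ge`). Averaging over all choices of the optimal actions gives a
single choice for which, over all `i`, playing the optimal action often is unlikely.

When `A` is at most a large constant times the logarithmic factor, the claimed lower bound is not
positive, and it suffices that the regret is nonnegative. Otherwise `(1 - γ) T / S` is huge, which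
makes all lower order terms negligible.
-/

noncomputable section

/-! ### Integrals of functions of finitely many steps -/

namespace DiscountedMDP

section Past

variable {X : Type}

/-- A trajectory with the prescribed values up to time `n`; the later values are irrelevant. -/
def ofPast (n : ℕ) (y : (i : Finset.Iic n) → X) : ℕ → X :=
  fun k => if hk : k ≤ n then y ⟨k, Finset.mem_Iic.2 hk⟩ else y ⟨0, Finset.mem_Iic.2 n.zero_le⟩

lemma ofPast_of_le {n k : ℕ} (y : (i : Finset.Iic n) → X) (hk : k ≤ n) :
    ofPast n y k = y ⟨k, Finset.mem_Iic.2 hk⟩ := dif_pos hk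

lemma dependsOn_eq_ofPast {β : Type*} {n : ℕ} {F : (ℕ → X) → β} (hF : DependsOn F (Set.Iic n))
    (ω : ℕ → X) : F ω = F (ofPast n (Preorder.frestrictLe n ω)) :=
  hF fun i hi => by rw [ofPast_of_le _ hi]; rfl

variable [Fintype X] [MeasurableSpace X] [MeasurableSingletonClass X]

lemma measurable_of_dependsOn {n : ℕ} {F : (ℕ → X) → ℝ} (hF : DependsOn F (Set.Iic n)) :
    Measurable F := by
  have : F = (fun y => F (ofPast n y)) ∘ Preorder.frestrictLe (π := fun _ : ℕ => X) n :=
    funext fun ω => dependsOn_eq_ofPast hF ω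
  rw [this]
  exact (measurable_of_countable _).comp (by fun_prop)

lemma integrable_of_dependsOn {n : ℕ} {F : (ℕ → X) → ℝ} (hF : DependsOn F (Set.Iic n))
    (μ : Measure (ℕ → X)) [IsFiniteMeasure μ] : Integrable F μ := by
  have hF' : F = (fun y => F (ofPast n y)) ∘ Preorder.frestrictLe (π := fun _ : ℕ => X) n :=
    funext fun ω => dependsOn_eq_ofPast hF ω
  refine Integrable.of_bound (measurable_of_dependsOn hF).aestronglyMeasurable
    (∑ y : (i : Finset.Iic n) → X, |F (ofPast n y)|) (Filter.Eventually.of_forall fun ω => ?_)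
  rw [dependsOn_eq_ofPast hF, Real.norm_eq_abs]
  exact Finset.single_le_sum (f := fun y : (i : Finset.Iic n) → X => |F (ofPast n y)|)
    (fun _ _ => abs_nonneg _) (Finset.mem_univ (Preorder.frestrictLe n ω))

end Past

section StepMean

variable {𝒮 𝒜 : Type} [Fintype 𝒮] [Fintype 𝒜]

open scoped Classical in
/-- The conditional expectation of a function `G` of the pairs at times `0, …, n + 1` given the pairs
at times `0, …, n`. -/
def stepMean (M : DiscountedMDP 𝒮 𝒜) (π : Policy 𝒮 𝒜) (n : ℕ) (G : (ℕ → 𝒮 × 𝒜) → ℝ)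
    (ω : ℕ → 𝒮 × 𝒜) : ℝ :=
  ∑ s', (M.trans (ω n).1 (ω n).2 s').toReal *
    ∑ a', (π (n + 1) (fun i => ω i) s' a').toReal * G (Function.update ω (n + 1) (s', a'))

lemma dependsOn_stepMean (M : DiscountedMDP 𝒮 𝒜) (π : Policy 𝒮 𝒜) (n : ℕ)
    {G : (ℕ → 𝒮 × 𝒜) → ℝ} (hG : DependsOn G (Set.Iic (n + 1))) :
    DependsOn (M.stepMean π n G) (Set.Iic n) := by
  intro x y hxy
  have h1 : (fun i : Fin (n + 1) => x i) = fun i : Fin (n + 1) => y i :=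
    funext fun i => hxy i (Nat.le_of_lt_succ i.2)
  have h2 : ∀ z, G (Function.update x (n + 1) z) = G (Function.update y (n + 1) z) := by
    intro z
    refine hG fun i hi => ?_
    by_cases hin : i = n + 1
    · subst hin; simp
    · rw [Function.update_of_ne hin, Function.update_of_ne hin]
      exact hxy i (by have : i ≤ n + 1 := hi; exact Set.mem_Iic.2 (by omega))
  simp only [stepMean]
  rw [hxy n (Set.mem_Iic.2 le_rfl), h1]
  simp only [h2]

end StepMean

variable {𝒮 𝒜 : Type} [Fintype 𝒮] [Fintype 𝒜] [MeasurableSpace 𝒮] [MeasurableSpace 𝒜]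
  [MeasurableSingletonClass 𝒮] [MeasurableSingletonClass 𝒜]

lemma sum_toReal_pmf {α : Type} [Fintype α] (p : PMF α) : ∑ a, (p a).toReal = 1 := by
  rw [← ENNReal.toReal_sum fun a _ => p.apply_ne_top a, ← tsum_fintype (L := .unconditional _),
    p.tsum_coe, ENNReal.toReal_one]

instance isProbabilityMeasure_lawGiven (M : DiscountedMDP 𝒮 𝒜) (π : Policy 𝒮 𝒜) (n : ℕ)
    (h : Fin n → 𝒮 × 𝒜) (s : 𝒮) : IsProbabilityMeasure (M.lawGiven π n h s) := by
  refine ⟨?_⟩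
  rw [lawGiven, Measure.finsetSum_apply]
  simp only [Measure.smul_apply, measure_univ, smul_eq_mul, mul_one]
  rw [← tsum_fintype (L := .unconditional _), PMF.tsum_coe]

instance isProbabilityMeasure_law (M : DiscountedMDP 𝒮 𝒜) (π : Policy 𝒮 𝒜) (s : 𝒮) :
    IsProbabilityMeasure (M.law π s) := isProbabilityMeasure_lawGiven M π 0 _ s

lemma integral_lawGiven (M : DiscountedMDP 𝒮 𝒜) (π : Policy 𝒮 𝒜) (n : ℕ)
    (h : Fin n → 𝒮 × 𝒜) (s : 𝒮) {m : ℕ} {G : (ℕ → 𝒮 × 𝒜) → ℝ} (hG : DependsOn G (Set.Iic m)) :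
    ∫ ω, G ω ∂(M.lawGiven π n h s) = ∑ a, (π n h s a).toReal *
      ∫ ω, G ω ∂(Kernel.traj (X := fun _ => 𝒮 × 𝒜) (M.stepKernel π) n
        (extendHistory n h (s, a))) := by
  rw [lawGiven, integral_finsetSum_measure]
  · refine Finset.sum_congr rfl fun a _ => ?_
    rw [integral_smul_measure, smul_eq_mul]
  · intro a _
    exact (integrable_of_dependsOn hG _).smul_measure ((π n h s).apply_ne_top a)

/-- Functions of the first `n + 1` pairs only see the randomness of the action at time `n`. -/
lemma integral_lawGiven_of_dependsOn (M : DiscountedMDP 𝒮 𝒜) (π : Policy 𝒮 𝒜) (n : ℕ)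
    (h : Fin n → 𝒮 × 𝒜) (s : 𝒮) {G : (ℕ → 𝒮 × 𝒜) → ℝ} (hG : DependsOn G (Set.Iic n)) :
    ∫ ω, G ω ∂(M.lawGiven π n h s) =
      ∑ a, (π n h s a).toReal * G (ofPast n (extendHistory n h (s, a))) := by
  rw [integral_lawGiven M π n h s hG]
  refine Finset.sum_congr rfl fun a _ => ?_
  congr 1
  rw [show G = fun ω => G (ofPast n (Preorder.frestrictLe n ω)) from
      funext fun ω => dependsOn_eq_ofPast hG ω,
    ← integral_map (φ := Preorder.frestrictLe (π := fun _ : ℕ => 𝒮 × 𝒜) n)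
    (f := fun y => G (ofPast n y)) (by fun_prop)
    (measurable_of_countable _).aestronglyMeasurable, Kernel.traj_map_frestrictLe_apply,
    Kernel.partialTraj_self, Kernel.id_apply, integral_dirac]
  exact dependsOn_eq_ofPast hG _

/-- The transition kernel draws the next state from the transition probabilities and then the action
from the policy. -/
lemma integral_stepKernel (M : DiscountedMDP 𝒮 𝒜) (π : Policy 𝒮 𝒜) (n : ℕ) (ω : ℕ → 𝒮 × 𝒜)
    (f : 𝒮 × 𝒜 → ℝ) :
    ∫ x, f x ∂(M.stepKernel π n (Preorder.frestrictLe n ω)) =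
      ∑ s', (M.trans (ω n).1 (ω n).2 s').toReal *
        ∑ a', (π (n + 1) (fun i => ω i) s' a').toReal * f (s', a') := by
  show ∫ x, f x ∂(PMF.toMeasure _) = _
  rw [PMF.integral_eq_sum, Fintype.sum_prod_type]
  refine Finset.sum_congr rfl fun s' _ => ?_
  rw [Finset.mul_sum]
  refine Finset.sum_congr rfl fun a' _ => ?_
  rw [smul_eq_mul, ← mul_assoc]
  congr 1
  rw [PMF.bind_apply, tsum_eq_single s', PMF.map_apply, tsum_eq_single a', if_pos rfl,
    ENNReal.toReal_mul]
  · rfl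
  · intro b hb
    rw [if_neg]
    rintro h
    exact hb (Prod.ext_iff.1 h).2.symm
  · intro b hb
    rw [PMF.map_apply, mul_eq_zero]
    refine Or.inr (ENNReal.tsum_eq_zero.2 fun c => if_neg ?_)
    rintro h
    exact hb (Prod.ext_iff.1 h).1.symm

/-- The Markov property in integrated form. -/
lemma integral_eq_integral_stepMean (M : DiscountedMDP 𝒮 𝒜) (π : Policy 𝒮 𝒜) {m n : ℕ} (hmn : m ≤ n)
    (h : Fin m → 𝒮 × 𝒜) (s : 𝒮) {G : (ℕ → 𝒮 × 𝒜) → ℝ} (hG : DependsOn G (Set.Iic (n + 1))) :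
    ∫ ω, G ω ∂(M.lawGiven π m h s) = ∫ ω, M.stepMean π n G ω ∂(M.lawGiven π m h s) := by
  classical
  rw [integral_lawGiven M π m h s hG, integral_lawGiven M π m h s (M.dependsOn_stepMean π n hG)]
  refine Finset.sum_congr rfl fun a _ => ?_
  congr 1
  set x₀ : (i : Finset.Iic m) → 𝒮 × 𝒜 := extendHistory m h (s, a)
  let g : ((i : Finset.Iic n) → 𝒮 × 𝒜) × (𝒮 × 𝒜) → ℝ :=
    fun p => G (Function.update (ofPast n p.1) (n + 1) p.2)
  have hg : ∀ (ω : ℕ → 𝒮 × 𝒜) (z : 𝒮 × 𝒜), g (Preorder.frestrictLe n ω, z) =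
      G (Function.update ω (n + 1) z) := by
    intro ω z
    refine hG fun i hi => ?_
    by_cases hin : i = n + 1
    · subst hin; simp
    · have : i ≤ n := by have : i ≤ n + 1 := hi; omega
      rw [Function.update_of_ne hin, Function.update_of_ne hin, ofPast_of_le _ this]; rfl
  have hGg : ∀ ω, G ω = g (Preorder.frestrictLe n ω, ω (n + 1)) := by
    intro ω; rw [hg, Function.update_eq_self]
  have hgm : Measurable g := measurable_of_countable _
  have hgi : ∀ (μ : Measure (((i : Finset.Iic n) → 𝒮 × 𝒜) × (𝒮 × 𝒜))) [IsFiniteMeasure μ],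
      Integrable g μ := fun μ _ => .of_finite
  have key := Kernel.partialTraj_compProd_eq_map_traj (X := fun _ => 𝒮 × 𝒜)
    (κ := M.stepKernel π) hmn (x₀ := x₀)
  calc ∫ ω, G ω ∂(Kernel.traj (X := fun _ => 𝒮 × 𝒜) (M.stepKernel π) m x₀)
      = ∫ ω, g (Preorder.frestrictLe n ω, ω (n + 1))
          ∂(Kernel.traj (X := fun _ => 𝒮 × 𝒜) (M.stepKernel π) m x₀) := by simp_rw [← hGg]
    _ = ∫ p, g p ∂((Kernel.traj (X := fun _ => 𝒮 × 𝒜) (M.stepKernel π) m x₀).map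
          fun x => (Preorder.frestrictLe n x, x (n + 1))) := by
        rw [integral_map (by fun_prop) hgm.aestronglyMeasurable]
    _ = ∫ y, ∫ z, g (y, z) ∂(M.stepKernel π n y)
          ∂(Kernel.partialTraj (X := fun _ => 𝒮 × 𝒜) (M.stepKernel π) m n x₀) := by
        rw [← key, Measure.integral_compProd (hgi _)]
    _ = _ := by
        rw [← Kernel.traj_map_frestrictLe_apply, integral_map (by fun_prop)
          (measurable_of_countable _).aestronglyMeasurable]
        refine integral_congr_ae (Filter.Eventually.of_forall fun ω => ?_)
        simp only [hg]
        rw [integral_stepKernel]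
        rfl


/-- The tower property: averaging the conditional law given the first `n` pairs and the state at
time `n` gives back the law of the trajectory. -/
lemma integral_integral_lawGiven (M : DiscountedMDP 𝒮 𝒜) (π : Policy 𝒮 𝒜) (s : 𝒮) {n m : ℕ}
    (hnm : n ≤ m) {G : (ℕ → 𝒮 × 𝒜) → ℝ} (hG : DependsOn G (Set.Iic m)) :
    ∫ ω, (∫ ω', G ω' ∂(M.lawGiven π n (fun i => ω i) (ω n).1)) ∂(M.law π s) =
      ∫ ω, G ω ∂(M.law π s) := by
  classical
  induction m, hnm using Nat.le_induction generalizing G with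
  | base =>
    simp_rw [fun (ω : ℕ → 𝒮 × 𝒜) =>
      M.integral_lawGiven_of_dependsOn π n (fun i => ω i) (ω n).1 hG]
    have hdep : DependsOn (fun ω : ℕ → 𝒮 × 𝒜 => ∑ a, (π n (fun i => ω i) (ω n).1 a).toReal *
        G (ofPast n (extendHistory n (fun i => ω i) ((ω n).1, a)))) (Set.Iic n) := by
      intro x y hxy
      have h1 : (fun i : Fin n => x i) = fun i : Fin n => y i :=
        funext fun i => hxy i i.2.le
      simp only [h1, hxy n (Set.mem_Iic.2 le_rfl)]
    cases n with
    | zero =>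
      rw [law, integral_lawGiven_of_dependsOn M π 0 _ s hdep,
        integral_lawGiven_of_dependsOn M π 0 _ s hG]
      have h0 : ∀ a : 𝒜, ofPast 0 (extendHistory 0 Fin.elim0 (s, a)) 0 = (s, a) := fun a => rfl
      have h1 : ∀ ω : ℕ → 𝒮 × 𝒜, (fun i : Fin 0 => ω i) = Fin.elim0 :=
        fun ω => Subsingleton.elim _ _
      simp only [h0, h1]
      rw [← Finset.sum_mul, sum_toReal_pmf, one_mul]
    | succ k =>
      rw [law, integral_eq_integral_stepMean M π (Nat.zero_le k) _ s hdep,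
        integral_eq_integral_stepMean M π (Nat.zero_le k) _ s hG]
      congr 1
      funext ω
      refine Finset.sum_congr rfl fun s' _ => ?_
      congr 1
      have h1 : ∀ z, (fun i : Fin (k + 1) => Function.update ω (k + 1) z i) =
          fun i : Fin (k + 1) => ω i :=
        fun z => funext fun i => Function.update_of_ne (by omega) _ _
      have h2 : ∀ a, G (ofPast (k + 1) (extendHistory (k + 1) (fun i => ω i) (s', a))) =
          G (Function.update ω (k + 1) (s', a)) := by
        intro a
        refine hG fun i hi => ?_
        rw [ofPast_of_le _ hi]
        by_cases hik : i = k + 1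
        · subst hik
          simp [extendHistory]
        · have : i < k + 1 := lt_of_le_of_ne hi hik
          rw [Function.update_of_ne hik, extendHistory, dif_pos this]
      simp only [h1, Function.update_self, h2]
      rw [← Finset.sum_mul, sum_toReal_pmf, one_mul]
  | succ m hm ih =>
    simp_rw [fun (ω : ℕ → 𝒮 × 𝒜) =>
      M.integral_eq_integral_stepMean π hm (fun i : Fin n => ω i) (ω n).1 hG]
    rw [ih (M.dependsOn_stepMean π m hG), law,
      integral_eq_integral_stepMean M π (Nat.zero_le m) _ s hG]

/-- Change of measure between two decision processes run under the same policy: the density of the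
first `n` transitions is the product of the densities of the single transitions. -/
lemma integral_law_eq_integral_mul_prod (M M' : DiscountedMDP 𝒮 𝒜) (π : Policy 𝒮 𝒜) (s : 𝒮)
    (l : 𝒮 → 𝒜 → 𝒮 → ℝ)
    (hl : ∀ s a s', (M'.trans s a s').toReal = (M.trans s a s').toReal * l s a s')
    {n : ℕ} {F : (ℕ → 𝒮 × 𝒜) → ℝ} (hF : DependsOn F (Set.Iic n)) :
    ∫ ω, F ω ∂(M'.law π s) =
      ∫ ω, F ω * ∏ t ∈ Finset.range n, l (ω t).1 (ω t).2 (ω (t + 1)).1 ∂(M.law π s) := by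
  classical
  have hprod : ∀ n : ℕ, DependsOn (fun ω : ℕ → 𝒮 × 𝒜 =>
      ∏ t ∈ Finset.range n, l (ω t).1 (ω t).2 (ω (t + 1)).1) (Set.Iic n) := by
    intro n x y hxy
    refine Finset.prod_congr rfl fun t ht => ?_
    have := Finset.mem_range.1 ht
    rw [hxy t (Set.mem_Iic.2 this.le), hxy (t + 1) this]
  have hmul : ∀ {n : ℕ} {F : (ℕ → 𝒮 × 𝒜) → ℝ}, DependsOn F (Set.Iic n) →
      DependsOn (fun ω => F ω * ∏ t ∈ Finset.range n, l (ω t).1 (ω t).2 (ω (t + 1)).1)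
        (Set.Iic n) := fun {n F} hF x y hxy => by
    have h1 := hprod n hxy
    simp only at h1
    simp only [hF hxy, h1]
  induction n generalizing F with
  | zero =>
    rw [law, law, integral_lawGiven_of_dependsOn M' π 0 _ s hF,
      integral_lawGiven_of_dependsOn M π 0 _ s (hmul hF)]
    simp
  | succ n ih =>
    rw [law, integral_eq_integral_stepMean M' π (Nat.zero_le n) _ s hF]
    have := ih (M'.dependsOn_stepMean π n hF)
    rw [law] at this
    rw [this, law, integral_eq_integral_stepMean M π (Nat.zero_le n) _ s (hmul hF)]
    congr 1
    funext ω
    simp only [stepMean]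
    rw [Finset.sum_mul]
    refine Finset.sum_congr rfl fun s' _ => ?_
    rw [hl, mul_assoc, mul_assoc]
    congr 1
    rw [Finset.sum_mul, Finset.mul_sum]
    refine Finset.sum_congr rfl fun a' _ => ?_
    have hp := hprod n (x := Function.update ω (n + 1) (s', a')) (y := ω) fun i hi =>
      Function.update_of_ne (by have : i ≤ n := hi; omega) _ _
    simp only at hp
    rw [Finset.prod_range_succ, hp, Function.update_self,
      Function.update_of_ne (by omega : n ≠ n + 1)]
    ring

/-- Conditional expectation of a function of the next state, weighted by a function of the past. -/
lemma integral_mul_nextState (M : DiscountedMDP 𝒮 𝒜) (π : Policy 𝒮 𝒜) {m n : ℕ} (hmn : m ≤ n)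
    (h : Fin m → 𝒮 × 𝒜) (s : 𝒮) {F : (ℕ → 𝒮 × 𝒜) → ℝ} (hF : DependsOn F (Set.Iic n))
    (φ : 𝒮 × 𝒜 → 𝒮 → ℝ) :
    ∫ ω, F ω * φ (ω n) (ω (n + 1)).1 ∂(M.lawGiven π m h s) =
      ∫ ω, F ω * ∑ s', (M.trans (ω n).1 (ω n).2 s').toReal * φ (ω n) s' ∂(M.lawGiven π m h s) := by
  classical
  have hdep : DependsOn (fun ω : ℕ → 𝒮 × 𝒜 => F ω * φ (ω n) (ω (n + 1)).1) (Set.Iic (n + 1)) := by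
    intro x y hxy
    simp only
    rw [hxy n (Set.mem_Iic.2 (Nat.le_succ n)), hxy (n + 1) (Set.mem_Iic.2 le_rfl),
      hF fun i hi => hxy i (le_trans hi (Nat.le_succ n))]
  rw [integral_eq_integral_stepMean M π hmn h s hdep]
  congr 1
  funext ω
  have hFu : ∀ z, F (Function.update ω (n + 1) z) = F ω := fun z => hF fun i hi =>
    Function.update_of_ne (by have : i ≤ n := hi; omega) _ _
  simp only [stepMean, Function.update_self, hFu, Function.update_of_ne (by omega : n ≠ n + 1)]
  rw [Finset.mul_sum]
  refine Finset.sum_congr rfl fun s' _ => ?_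
  rw [← Finset.sum_mul, sum_toReal_pmf]
  ring

lemma ae_trans_ne_zero (M : DiscountedMDP 𝒮 𝒜) (π : Policy 𝒮 𝒜) (s : 𝒮) :
    ∀ᵐ ω ∂(M.law π s), ∀ t, M.trans (ω t).1 (ω t).2 (ω (t + 1)).1 ≠ 0 := by
  classical
  refine ae_all_iff.2 fun t => ?_
  let φ : 𝒮 × 𝒜 → 𝒮 → ℝ := fun x s' => if M.trans x.1 x.2 s' = 0 then 1 else 0
  have h1 := M.integral_mul_nextState π (Nat.zero_le t) Fin.elim0 s (F := fun _ => 1)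
    (fun _ _ _ => rfl) φ
  have h2 : ∀ x : 𝒮 × 𝒜, ∑ s', (M.trans x.1 x.2 s').toReal * φ x s' = 0 := by
    refine fun x => Finset.sum_eq_zero fun s' _ => ?_
    simp only [φ]
    split_ifs with h
    · rw [h]; simp
    · simp
  simp only [h2, one_mul, integral_zero] at h1
  have hdep : DependsOn (fun ω : ℕ → 𝒮 × 𝒜 => φ (ω t) (ω (t + 1)).1) (Set.Iic (t + 1)) := by
    intro x y hxy
    simp only
    rw [hxy t (Set.mem_Iic.2 (Nat.le_succ t)), hxy (t + 1) (Set.mem_Iic.2 le_rfl)]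
  rw [integral_eq_zero_iff_of_nonneg (fun ω => ?_) (integrable_of_dependsOn hdep _)] at h1
  · filter_upwards [h1] with ω hω h0
    simp [φ, h0] at hω
  · simp only [φ, Pi.zero_apply]
    split_ifs <;> norm_num

end DiscountedMDP

/-! ### Values and regret in terms of suboptimality gaps -/

namespace DiscountedMDP

variable {𝒮 𝒜 : Type} [Fintype 𝒮] [Fintype 𝒜] [MeasurableSpace 𝒮] [MeasurableSpace 𝒜]
  [MeasurableSingletonClass 𝒮] [MeasurableSingletonClass 𝒜]

/-- `v` solves the Bellman equation of `M` up to the loss `gap s a` of playing `a` in `s`; when the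
gaps are nonnegative and vanish for some action in each state, `v` is the optimal value function and
`gap` the suboptimality gap. -/
def HasGap (M : DiscountedMDP 𝒮 𝒜) (v : 𝒮 → ℝ) (gap : 𝒮 × 𝒜 → ℝ) : Prop :=
  ∀ s a, v s = M.reward s a + M.discount * ∑ s', (M.trans s a s').toReal * v s' + gap (s, a)

lemma dependsOn_eval {X : Type} (φ : X → ℝ) (n : ℕ) :
    DependsOn (fun ω : ℕ → X => φ (ω n)) (Set.Iic n) := fun x y hxy => by
  simp only
  rw [hxy n (Set.mem_Iic.2 le_rfl)]

lemma integrable_eval (μ : Measure (ℕ → 𝒮 × 𝒜)) [IsFiniteMeasure μ] (φ : 𝒮 × 𝒜 → ℝ) (n : ℕ) :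
    Integrable (fun ω : ℕ → 𝒮 × 𝒜 => φ (ω n)) μ :=
  integrable_of_dependsOn (dependsOn_eval φ n) μ

/-- The Bellman equation telescopes along a trajectory. -/
lemma sum_discounted_reward {M : DiscountedMDP 𝒮 𝒜} {v : 𝒮 → ℝ} {gap : 𝒮 × 𝒜 → ℝ}
    (hv : M.HasGap v gap) (π : Policy 𝒮 𝒜) (n : ℕ) (h : Fin n → 𝒮 × 𝒜) (s : 𝒮) (k : ℕ) :
    ∑ i ∈ Finset.range k,
        M.discount ^ i * ∫ ω, M.reward (ω (n + i)).1 (ω (n + i)).2 ∂(M.lawGiven π n h s) =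
      v s - M.discount ^ k * ∫ ω, v (ω (n + k)).1 ∂(M.lawGiven π n h s) -
        ∑ i ∈ Finset.range k, M.discount ^ i * ∫ ω, gap (ω (n + i)) ∂(M.lawGiven π n h s) := by
  induction k with
  | zero =>
    have h0 := M.integral_lawGiven_of_dependsOn π n h s (dependsOn_eval (fun x => v x.1) n)
    have h1 : ∀ a, ofPast n (extendHistory n h (s, a)) n = (s, a) := by
      intro a
      rw [ofPast_of_le _ le_rfl]
      simp [extendHistory]
    simp only [h1] at h0
    rw [← Finset.sum_mul, sum_toReal_pmf, one_mul] at h0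
    simp [h0]
  | succ k ih =>
    have h1 := M.integral_mul_nextState π (Nat.le_add_right n k) h s (F := fun _ => 1)
      (fun _ _ _ => rfl) (fun _ s' => v s')
    simp only [one_mul] at h1
    have h2 : ∫ ω, v (ω (n + k)).1 ∂(M.lawGiven π n h s) =
        ∫ ω, M.reward (ω (n + k)).1 (ω (n + k)).2 ∂(M.lawGiven π n h s) +
        M.discount * ∫ ω, v (ω (n + k + 1)).1 ∂(M.lawGiven π n h s) +
        ∫ ω, gap (ω (n + k)) ∂(M.lawGiven π n h s) := by
      rw [h1, ← integral_const_mul, ← integral_add, ← integral_add]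
      · exact integral_congr_ae (Filter.Eventually.of_forall fun ω => hv _ _)
      · exact integrable_eval _ (fun x => M.reward x.1 x.2 +
          M.discount * ∑ s', (M.trans x.1 x.2 s').toReal * v s') _
      · exact integrable_eval _ gap _
      · exact integrable_eval _ (fun x => M.reward x.1 x.2) _
      · exact integrable_eval _ (fun x =>
          M.discount * ∑ s', (M.trans x.1 x.2 s').toReal * v s') _
    rw [Finset.sum_range_succ, Finset.sum_range_succ, ih, h2, ← add_assoc]
    ring

lemma hasSum_value (M : DiscountedMDP 𝒮 𝒜) (π : Policy 𝒮 𝒜) (n : ℕ) (h : Fin n → 𝒮 × 𝒜)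
    (s : 𝒮) :
    HasSum (fun i : ℕ => M.discount ^ i *
      ∫ ω, M.reward (ω (n + i)).1 (ω (n + i)).2 ∂(M.lawGiven π n h s)) (M.value π n h s) := by
  have key := hasSum_integral_of_summable_integral_norm (μ := M.lawGiven π n h s)
    (F := fun (i : ℕ) (ω : ℕ → 𝒮 × 𝒜) =>
      M.discount ^ i * M.reward (ω (n + i)).1 (ω (n + i)).2)
    (fun i => integrable_eval _ (fun x => M.discount ^ i * M.reward x.1 x.2) _) ?_
  · simp_rw [integral_const_mul] at key
    exact key
  · refine Summable.of_nonneg_of_le (fun i => integral_nonneg fun ω => norm_nonneg _) (fun i => ?_)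
      (summable_geometric_of_lt_one M.discount_pos.le M.discount_lt_one)
    have hp : 0 ≤ M.discount ^ i := pow_nonneg M.discount_pos.le i
    calc ∫ ω, ‖M.discount ^ i * M.reward (ω (n + i)).1 (ω (n + i)).2‖ ∂(M.lawGiven π n h s)
        ≤ ∫ _, M.discount ^ i ∂(M.lawGiven π n h s) := by
          refine integral_mono (integrable_eval _
            (fun x => ‖M.discount ^ i * M.reward x.1 x.2‖) _) (integrable_const _) fun ω => ?_
          have hr := M.reward_mem (ω (n + i)).1 (ω (n + i)).2
          simp only
          rw [Real.norm_eq_abs, abs_of_nonneg (mul_nonneg hp hr.1)]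
          exact mul_le_of_le_one_right hp hr.2
      _ = M.discount ^ i := by simp

lemma tendsto_discount_mul_integral (M : DiscountedMDP 𝒮 𝒜) (π : Policy 𝒮 𝒜) (n : ℕ)
    (h : Fin n → 𝒮 × 𝒜) (s : 𝒮) (v : 𝒮 → ℝ) :
    Filter.Tendsto (fun k => M.discount ^ k * ∫ ω, v (ω (n + k)).1 ∂(M.lawGiven π n h s))
      Filter.atTop (nhds 0) := by
  have hb : ∀ k, |∫ ω, v (ω (n + k)).1 ∂(M.lawGiven π n h s)| ≤ ∑ s, |v s| := by
    intro k
    have := norm_integral_le_of_norm_le_const (μ := M.lawGiven π n h s)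
      (f := fun ω => v (ω (n + k)).1) (C := ∑ s, |v s|)
      (Filter.Eventually.of_forall fun ω => Finset.single_le_sum (f := fun s => |v s|)
        (fun _ _ => abs_nonneg _) (Finset.mem_univ (ω (n + k)).1))
    simpa using this
  have h0 := (tendsto_pow_atTop_nhds_zero_of_lt_one M.discount_pos.le M.discount_lt_one).mul_const
    (∑ s, |v s|)
  rw [zero_mul] at h0
  refine squeeze_zero_norm (fun k => ?_) h0
  rw [Real.norm_eq_abs, abs_mul, abs_of_nonneg (pow_nonneg M.discount_pos.le k)]
  exact mul_le_mul_of_nonneg_left (hb k) (pow_nonneg M.discount_pos.le k)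

/-- The value is `v` minus the expected discounted sum of the gaps, which is truncated here. -/
lemma value_le {M : DiscountedMDP 𝒮 𝒜} {v : 𝒮 → ℝ} {gap : 𝒮 × 𝒜 → ℝ}
    (hv : M.HasGap v gap) (hgap : ∀ x, 0 ≤ gap x) (π : Policy 𝒮 𝒜) (n : ℕ)
    (h : Fin n → 𝒮 × 𝒜) (s : 𝒮) (k : ℕ) :
    M.value π n h s ≤ v s -
      ∑ i ∈ Finset.range k, M.discount ^ i * ∫ ω, gap (ω (n + i)) ∂(M.lawGiven π n h s) := by
  have h1 := (M.hasSum_value π n h s).tendsto_sum_nat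
  have h2 := (M.tendsto_discount_mul_integral π n h s v).const_sub (v s -
      ∑ i ∈ Finset.range k, M.discount ^ i * ∫ ω, gap (ω (n + i)) ∂(M.lawGiven π n h s))
  rw [sub_zero] at h2
  refine le_of_tendsto_of_tendsto h1 h2 ?_
  filter_upwards [Filter.eventually_ge_atTop k] with N hN
  rw [sum_discounted_reward hv]
  have : ∑ i ∈ Finset.range k, M.discount ^ i * ∫ ω, gap (ω (n + i)) ∂(M.lawGiven π n h s) ≤
      ∑ i ∈ Finset.range N, M.discount ^ i * ∫ ω, gap (ω (n + i)) ∂(M.lawGiven π n h s) :=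
    Finset.sum_le_sum_of_subset_of_nonneg (Finset.range_mono hN) fun i _ _ =>
      mul_nonneg (pow_nonneg M.discount_pos.le i) (integral_nonneg fun ω => hgap _)
  linarith

/-- The stationary policy that plays `f s` in the state `s`. -/
def greedy (f : 𝒮 → 𝒜) : Policy 𝒮 𝒜 := fun _ _ s => PMF.pure (f s)

lemma integral_greedy_eq_zero (M : DiscountedMDP 𝒮 𝒜) (f : 𝒮 → 𝒜) (s : 𝒮) {φ : 𝒮 × 𝒜 → ℝ}
    (hφ : ∀ s, φ (s, f s) = 0) (n : ℕ) :
    ∫ ω, φ (ω n) ∂(M.lawGiven (greedy f) 0 Fin.elim0 s) = 0 := by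
  classical
  have hz : ∀ s' : 𝒮, ∑ a, (PMF.pure (f s') a).toReal * φ (s', a) = 0 := by
    refine fun s' => Finset.sum_eq_zero fun a _ => ?_
    by_cases ha : a = f s'
    · rw [ha, hφ, mul_zero]
    · simp [PMF.pure_apply, ha]
  cases n with
  | zero =>
    rw [integral_lawGiven_of_dependsOn M _ 0 _ s (dependsOn_eval φ 0)]
    exact hz s
  | succ n =>
    rw [integral_eq_integral_stepMean M _ (Nat.zero_le n) _ s (dependsOn_eval φ (n + 1))]
    simp only [stepMean, greedy, Function.update_self, hz, mul_zero, Finset.sum_const_zero,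
      integral_zero]

/-- If every state has an action without gap, playing these actions has value `v`. -/
lemma le_optValue {M : DiscountedMDP 𝒮 𝒜} {v : 𝒮 → ℝ} {gap : 𝒮 × 𝒜 → ℝ}
    (hv : M.HasGap v gap) (hgap : ∀ x, 0 ≤ gap x) {f : 𝒮 → 𝒜} (hf : ∀ s, gap (s, f s) = 0)
    (s : 𝒮) : v s ≤ M.optValue s := by
  have hval : M.value (greedy f) 0 Fin.elim0 s = v s := by
    have h1 := (M.hasSum_value (greedy f) 0 Fin.elim0 s).tendsto_sum_nat
    have h2 := (M.tendsto_discount_mul_integral (greedy f) 0 Fin.elim0 s v).const_sub (v s)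
    rw [sub_zero] at h2
    refine tendsto_nhds_unique h1 (h2.congr fun N => ?_)
    rw [sum_discounted_reward hv]
    simp [integral_greedy_eq_zero M f s hf]
  rw [← hval]
  refine le_ciSup (f := fun π : Policy 𝒮 𝒜 => M.value π 0 Fin.elim0 s) ⟨v s, ?_⟩ (greedy f)
  rintro _ ⟨π, rfl⟩
  simpa using value_le hv hgap π 0 Fin.elim0 s 0

/-- Quantities computed from the conditional law at time `t` depend on the past only. -/
lemma dependsOn_lawGiven (M : DiscountedMDP 𝒮 𝒜) (π : Policy 𝒮 𝒜) (t : ℕ) {β : Type*}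
    (F : 𝒮 → Measure (ℕ → 𝒮 × 𝒜) → β) :
    DependsOn (fun ω : ℕ → 𝒮 × 𝒜 => F (ω t).1 (M.lawGiven π t (fun i => ω i) (ω t).1))
      (Set.Iic t) := fun x y hxy => by
  have h1 : (fun i : Fin t => x i) = fun i : Fin t => y i := funext fun i => hxy i i.2.le
  simp only
  rw [h1, hxy t (Set.mem_Iic.2 le_rfl)]

/-- The expected regret is at least the discounted sum of all gaps incurred before time `T`. -/
lemma sum_gap_le_expectedRegret {M : DiscountedMDP 𝒮 𝒜} {v : 𝒮 → ℝ} {gap : 𝒮 × 𝒜 → ℝ}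
    (hv : M.HasGap v gap) (hgap : ∀ x, 0 ≤ gap x) {f : 𝒮 → 𝒜} (hf : ∀ s, gap (s, f s) = 0)
    (π : Policy 𝒮 𝒜) (s : 𝒮) (T : ℕ) :
    ∑ t ∈ Finset.range T, ∑ i ∈ Finset.range (T - t),
      M.discount ^ i * ∫ ω, gap (ω (t + i)) ∂(M.law π s) ≤ M.expectedRegret π s T := by
  have hreg : ∀ t : ℕ, DependsOn (fun ω : ℕ → 𝒮 × 𝒜 =>
      M.optValue (ω t).1 - M.value π t (fun i => ω i) (ω t).1) (Set.Iic t) := fun t =>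
    M.dependsOn_lawGiven π t fun s μ => M.optValue s -
      ∫ ω, ∑' i : ℕ, M.discount ^ i * M.reward (ω (t + i)).1 (ω (t + i)).2 ∂μ
  rw [expectedRegret]
  simp only [regret]
  rw [integral_finsetSum _ fun t _ => integrable_of_dependsOn (hreg t) _]
  refine Finset.sum_le_sum fun t _ => ?_
  have hdep : ∀ i : ℕ, DependsOn (fun ω : ℕ → 𝒮 × 𝒜 =>
      M.discount ^ i * ∫ ω', gap (ω' (t + i)) ∂(M.lawGiven π t (fun i => ω i) (ω t).1))
      (Set.Iic t) := fun i =>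
    M.dependsOn_lawGiven π t fun _ μ => M.discount ^ i * ∫ ω', gap (ω' (t + i)) ∂μ
  calc ∑ i ∈ Finset.range (T - t), M.discount ^ i * ∫ ω, gap (ω (t + i)) ∂(M.law π s)
      = ∫ ω, ∑ i ∈ Finset.range (T - t), M.discount ^ i *
          ∫ ω', gap (ω' (t + i)) ∂(M.lawGiven π t (fun i => ω i) (ω t).1) ∂(M.law π s) := by
        rw [integral_finsetSum _ fun i _ => integrable_of_dependsOn (hdep i) _]
        refine Finset.sum_congr rfl fun i _ => ?_
        rw [integral_const_mul, M.integral_integral_lawGiven π s (Nat.le_add_right t i)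
          (dependsOn_eval gap (t + i))]
    _ ≤ _ := by
        refine integral_mono (integrable_finsetSum _ fun i _ => integrable_of_dependsOn (hdep i) _)
          (integrable_of_dependsOn (hreg t) _) fun ω => ?_
        have h1 := value_le hv hgap π t (fun i => ω i) (ω t).1 (T - t)
        have h2 := le_optValue hv hgap hf (ω t).1
        simp only
        linarith

lemma expectedRegret_nonneg {M : DiscountedMDP 𝒮 𝒜} {v : 𝒮 → ℝ} {gap : 𝒮 × 𝒜 → ℝ}
    (hv : M.HasGap v gap) (hgap : ∀ x, 0 ≤ gap x) {f : 𝒮 → 𝒜} (hf : ∀ s, gap (s, f s) = 0)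
    (π : Policy 𝒮 𝒜) (s : 𝒮) (T : ℕ) : 0 ≤ M.expectedRegret π s T :=
  (Finset.sum_nonneg fun _ _ => Finset.sum_nonneg fun i _ =>
    mul_nonneg (pow_nonneg M.discount_pos.le i) (integral_nonneg fun _ => hgap _)).trans
    (sum_gap_le_expectedRegret hv hgap hf π s T)

/-- The gap at time `u` is counted `(1 - γ ^ (u + 1)) / (1 - γ)` times; the missing geometric terms sum
to at most `D / (1 - γ) ^ 2`. -/
lemma sum_sum_geometric_ge {γ D : ℝ} (hγ0 : 0 ≤ γ) (hγ1 : γ < 1) {g : ℕ → ℝ}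
    (hg : ∀ u, 0 ≤ g u) (hgD : ∀ u, g u ≤ D) (T : ℕ) :
    (∑ u ∈ Finset.range T, g u - D / (1 - γ)) / (1 - γ) ≤
      ∑ t ∈ Finset.range T, ∑ i ∈ Finset.range (T - t), γ ^ i * g (t + i) := by
  have h1 : 0 < 1 - γ := by linarith
  have h2 : ∑ t ∈ Finset.range T, ∑ i ∈ Finset.range (T - t), γ ^ i * g (t + i) =
      ∑ u ∈ Finset.range T, (1 - γ ^ (u + 1)) / (1 - γ) * g u := by
    rw [← Finset.sum_range_diag_flip T fun t i => γ ^ i * g (t + i)]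
    refine Finset.sum_congr rfl fun u _ => ?_
    have h3 : ∀ k ∈ Finset.range (u + 1), γ ^ (u - k) * g (k + (u - k)) = γ ^ (u - k) * g u := by
      intro k hk
      have := Finset.mem_range.1 hk
      rw [show k + (u - k) = u by omega]
    rw [Finset.sum_congr rfl h3, ← Finset.sum_mul]
    congr 1
    have h4 := Finset.sum_range_reflect (fun k => γ ^ k) (u + 1)
    simp only [Nat.add_sub_cancel] at h4
    rw [h4, eq_div_iff h1.ne', ← geom_sum_mul_neg]
  have h5 : ∑ u ∈ Finset.range T, γ ^ (u + 1) * g u ≤ D / (1 - γ) := by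
    have hD : 0 ≤ D := (hg 0).trans (hgD 0)
    calc ∑ u ∈ Finset.range T, γ ^ (u + 1) * g u
        ≤ ∑ u ∈ Finset.range T, γ ^ u * D := by
          refine Finset.sum_le_sum fun u _ => mul_le_mul ?_ (hgD u) (hg u) (pow_nonneg hγ0 u)
          exact pow_le_pow_of_le_one hγ0 hγ1.le (Nat.le_succ u)
      _ = (∑ u ∈ Finset.range T, γ ^ u) * D := by rw [Finset.sum_mul]
      _ ≤ (1 - γ)⁻¹ * D := by
          refine mul_le_mul_of_nonneg_right ?_ hD
          rw [← tsum_geometric_of_lt_one hγ0 hγ1]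
          exact (summable_geometric_of_lt_one hγ0 hγ1).sum_le_tsum _
            fun i _ => pow_nonneg hγ0 i
      _ = D / (1 - γ) := by rw [div_eq_inv_mul]
  rw [h2, div_le_iff₀ h1, Finset.sum_mul]
  have h6 : ∀ u, (1 - γ ^ (u + 1)) / (1 - γ) * g u * (1 - γ) = g u - γ ^ (u + 1) * g u := by
    intro u
    field_simp
  simp only [h6, Finset.sum_sub_distrib]
  linarith

/-- Up to boundary effects, each suboptimal action before time `T` costs its gap for each of the
about `1 / (1 - γ)` value functions that still see it. -/
lemma expectedRegret_ge {M : DiscountedMDP 𝒮 𝒜} {v : 𝒮 → ℝ} {gap : 𝒮 × 𝒜 → ℝ} {D : ℝ}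
    (hv : M.HasGap v gap) (hgap : ∀ x, 0 ≤ gap x) (hD : ∀ x, gap x ≤ D)
    {f : 𝒮 → 𝒜} (hf : ∀ s, gap (s, f s) = 0) (π : Policy 𝒮 𝒜) (s : 𝒮) (T : ℕ) :
    (∑ t ∈ Finset.range T, ∫ ω, gap (ω t) ∂(M.law π s) - D / (1 - M.discount)) /
      (1 - M.discount) ≤ M.expectedRegret π s T := by
  refine le_trans ?_ (sum_gap_le_expectedRegret hv hgap hf π s T)
  refine sum_sum_geometric_ge M.discount_pos.le M.discount_lt_one
    (g := fun u => ∫ ω, gap (ω u) ∂(M.law π s))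
    (fun u => integral_nonneg fun _ => hgap _) (fun u => ?_) T
  calc ∫ ω, gap (ω u) ∂(M.law π s) ≤ ∫ _, D ∂(M.law π s) :=
        integral_mono (integrable_eval _ gap u) (integrable_const _) fun ω => hD _
    _ = D := by simp

end DiscountedMDP

/-! ### Visits, departures and laps -/

namespace DiscountedMDP

section Counts

variable {S : ℕ} {X : Type}

/-- The index of a node in the cyclic order. -/
def pos (x : Fin S × Fin 2) : ℕ := 2 * x.1 + x.2

lemma pos_injective : Function.Injective (pos (S := S)) := by
  rintro ⟨i, b⟩ ⟨j, c⟩ h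
  simp only [pos] at h
  have hb := b.2
  have hc := c.2
  ext <;> simp only <;> omega

lemma pos_lt (x : Fin S × Fin 2) : pos x < 2 * S := by
  have h1 := x.1.2
  have h2 := x.2.2
  simp only [pos]
  omega

/-- The number of visits to the node `x` before time `T`. -/
def visits (x : Fin S × Fin 2) (T : ℕ) (ω : ℕ → (Fin S × Fin 2) × X) : ℝ :=
  ∑ t ∈ Finset.range T, if (ω t).1 = x then 1 else 0

/-- The number of departures from the node `x` before time `T`. -/
def moves (x : Fin S × Fin 2) (T : ℕ) (ω : ℕ → (Fin S × Fin 2) × X) : ℝ :=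
  ∑ t ∈ Finset.range T, if (ω t).1 = x then (if (ω (t + 1)).1 = x then 0 else 1) else 0

/-- The number of completed laps, that is, departures from the last node, before time `T`. -/
def laps (T : ℕ) (ω : ℕ → (Fin S × Fin 2) × X) : ℝ :=
  ∑ t ∈ Finset.range T,
    if pos (ω t).1 + 1 = 2 * S then (if (ω (t + 1)).1 = (ω t).1 then 0 else 1) else 0

lemma sum_visits (T : ℕ) (ω : ℕ → (Fin S × Fin 2) × X) : ∑ x, visits x T ω = T := by
  simp only [visits]
  rw [Finset.sum_comm]
  simp

/-- The departures from `x` before time `T`, centred by their conditional probabilities. -/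
def deviation (p : Fin S × Fin 2 → X → ℝ) (x : Fin S × Fin 2) (T : ℕ)
    (ω : ℕ → (Fin S × Fin 2) × X) : ℝ :=
  ∑ t ∈ Finset.range T,
    if (ω t).1 = x then (if (ω (t + 1)).1 = x then 0 else 1) - p (ω t).1 (ω t).2 else 0

lemma mul_visits_le {p : Fin S × Fin 2 → X → ℝ} {θ θ' : ℝ}
    (hθ : ∀ x a, θ ≤ p x a) (hθ' : ∀ x a, p x a ≤ θ')
    (x : Fin S × Fin 2) (T : ℕ) (ω : ℕ → (Fin S × Fin 2) × X) :
    θ * visits x T ω ≤ moves x T ω - deviation p x T ω ∧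
      moves x T ω - deviation p x T ω ≤ θ' * visits x T ω := by
  simp only [visits, moves, deviation, Finset.mul_sum, ← Finset.sum_sub_distrib]
  constructor
  · refine Finset.sum_le_sum fun t _ => ?_
    by_cases h : (ω t).1 = x <;> simp [h, hθ]
  · refine Finset.sum_le_sum fun t _ => ?_
    by_cases h : (ω t).1 = x <;> simp [h, hθ']

end Counts

/-! ### Rings with general move probabilities -/

variable {S A : ℕ} [NeZero S] {X : Type}

/-- The successor of a node in the cyclic order `(0, 0), (0, 1), (1, 0), (1, 1), …`. -/
def next (x : Fin S × Fin 2) : Fin S × Fin 2 :=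
  if x.2 = 0 then (x.1, 1) else (x.1 + 1, 0)

lemma next_ne (x : Fin S × Fin 2) : next x ≠ x := by
  obtain ⟨i, b⟩ := x
  intro h
  have := congrArg Prod.snd h
  fin_cases b <;> simp [next] at this

/-- The probability to get from `x` to `y` on a ring whose current node is left with
probability `p`. -/
def ringProb (p : ℝ) (x y : Fin S × Fin 2) : ℝ :=
  if y = next x then p else if y = x then 1 - p else 0

lemma ringProb_nonneg {p : ℝ} (hp : p ∈ Set.Icc (0 : ℝ) 1) (x y : Fin S × Fin 2) :
    0 ≤ ringProb p x y := by
  rw [ringProb]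
  split_ifs
  · exact hp.1
  · linarith [hp.2]
  · exact le_rfl

lemma sum_ringProb_mul (p : ℝ) (x : Fin S × Fin 2) (φ : Fin S × Fin 2 → ℝ) :
    ∑ y, ringProb p x y * φ y = p * φ (next x) + (1 - p) * φ x := by
  rw [← Finset.add_sum_erase _ _ (Finset.mem_univ (next x)),
    ← Finset.add_sum_erase _ _ (Finset.mem_erase.2 ⟨(next_ne x).symm, Finset.mem_univ x⟩),
    Finset.sum_eq_zero]
  · simp [ringProb, (next_ne x).symm]
  · intro y hy
    simp only [Finset.mem_erase] at hy
    simp [ringProb, hy.1, hy.2.1]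

/-- The ring on which the action `a` leaves the node `x` with probability `p x a`. -/
def ringMDP (γ : ℝ) (hγ0 : 0 < γ) (hγ1 : γ < 1) (p : Fin S × Fin 2 → Fin A → ℝ)
    (hp : ∀ x a, p x a ∈ Set.Icc (0 : ℝ) 1) : DiscountedMDP (Fin S × Fin 2) (Fin A) where
  discount := γ
  discount_pos := hγ0
  discount_lt_one := hγ1
  reward x _ := if x.2 = 0 then 0 else 1
  reward_mem x _ := by split_ifs <;> simp
  trans x a := PMF.ofFintype (fun y => ENNReal.ofReal (ringProb (p x a) x y)) (by
    rw [← ENNReal.ofReal_sum_of_nonneg fun y _ => ringProb_nonneg (hp x a) x y]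
    have := sum_ringProb_mul (p x a) x fun _ => 1
    simp only [mul_one] at this
    rw [this]
    simp)

section Ring

variable {γ : ℝ} {hγ0 : 0 < γ} {hγ1 : γ < 1} {p : Fin S × Fin 2 → Fin A → ℝ}
  {hp : ∀ x a, p x a ∈ Set.Icc (0 : ℝ) 1}

lemma toReal_trans_ringMDP (x : Fin S × Fin 2) (a : Fin A) (y : Fin S × Fin 2) :
    ((ringMDP γ hγ0 hγ1 p hp).trans x a y).toReal = ringProb (p x a) x y := by
  show (ENNReal.ofReal _).toReal = _
  exact ENNReal.toReal_ofReal (ringProb_nonneg (hp x a) x y)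

lemma eq_or_eq_next_of_trans_ne_zero {x : Fin S × Fin 2} {a : Fin A} {y : Fin S × Fin 2}
    (h : (ringMDP γ hγ0 hγ1 p hp).trans x a y ≠ 0) : y = x ∨ y = next x := by
  by_contra! hn
  refine h ?_
  show ENNReal.ofReal _ = 0
  simp [ringProb, hn.1, hn.2]

end Ring

/-! ### Cyclic flow balance -/

lemma pos_next (x : Fin S × Fin 2) : pos (next x) = if pos x + 1 = 2 * S then 0 else pos x + 1 := by
  have hi := x.1.2
  have hb := x.2.2
  by_cases h0 : x.2 = 0
  · have h0' : (x.2 : ℕ) = 0 := by rw [h0]; rfl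
    have hn : pos (next x) = 2 * x.1 + 1 := by rw [next, if_pos h0]; rfl
    have hx : pos x = 2 * x.1 := by rw [pos, h0', add_zero]
    rw [hn, hx, if_neg (by omega)]
  · have h0' : (x.2 : ℕ) = 1 := by
      have : (x.2 : ℕ) ≠ 0 := fun h => h0 (Fin.ext h)
      omega
    have hn : pos (next x) = 2 * (((x.1 : ℕ) + 1) % S) := by
      rw [next, if_neg h0]
      show 2 * ((x.1 + 1 : Fin S) : ℕ) + 0 = _
      rw [Fin.val_add, Fin.val_one', Nat.add_mod_mod, add_zero]
    have hx : pos x = 2 * x.1 + 1 := by rw [pos, h0']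
    rw [hn, hx]
    by_cases h : (x.1 : ℕ) + 1 = S
    · rw [if_pos (by omega), h, Nat.mod_self]
    · rw [if_neg (by omega), Nat.mod_eq_of_lt (by omega)]
      omega

/-- All nodes are left equally often, up to one departure: the difference of the two counts is the
increment of the indicator of being past `x`. -/
lemma moves_sub_laps (x : Fin S × Fin 2) (T : ℕ) {ω : ℕ → (Fin S × Fin 2) × X}
    (hω : ∀ t, (ω (t + 1)).1 = (ω t).1 ∨ (ω (t + 1)).1 = next (ω t).1) :
    moves x T ω - laps T ω = (if pos x < pos (ω T).1 then 1 else 0) -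
      if pos x < pos (ω 0).1 then 1 else 0 := by
  induction T with
  | zero => simp [moves, laps]
  | succ T ih =>
    have h1 : moves x (T + 1) ω = moves x T ω +
        if (ω T).1 = x then (if (ω (T + 1)).1 = x then 0 else 1) else 0 :=
      Finset.sum_range_succ _ _
    have h2 : laps (T + 1) ω = laps T ω + if pos (ω T).1 + 1 = 2 * S then
        (if (ω (T + 1)).1 = (ω T).1 then 0 else 1) else 0 := Finset.sum_range_succ _ _
    have h3 : ((if pos x < pos (ω (T + 1)).1 then 1 else 0 : ℝ) -
        if pos x < pos (ω T).1 then 1 else 0) =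
        (if (ω T).1 = x then (if (ω (T + 1)).1 = x then 0 else 1) else 0) -
        if pos (ω T).1 + 1 = 2 * S then (if (ω (T + 1)).1 = (ω T).1 then 0 else 1) else 0 := by
      rcases hω T with h | h
      · rw [h]
        by_cases hx : (ω T).1 = x <;> simp [hx]
      · rw [h, pos_next]
        have hlt := pos_lt x
        have hlt' := pos_lt (ω T).1
        by_cases hx : (ω T).1 = x
        · by_cases hl : pos x + 1 = 2 * S <;> simp [hx, next_ne, hl]
        · have hne : pos (ω T).1 ≠ pos x := fun h => hx (pos_injective h)
          by_cases hl : pos (ω T).1 + 1 = 2 * S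
          · have : pos x < pos (ω T).1 := by omega
            simp [hx, hl, next_ne, this]
          · have : pos x < pos (ω T).1 + 1 ↔ pos x < pos (ω T).1 := by omega
            simp [hx, hl, this]
    rw [h1, h2]
    linarith

lemma abs_moves_sub_laps_le (x : Fin S × Fin 2) (T : ℕ) {ω : ℕ → (Fin S × Fin 2) × X}
    (hω : ∀ t, (ω (t + 1)).1 = (ω t).1 ∨ (ω (t + 1)).1 = next (ω t).1) :
    |moves x T ω - laps T ω| ≤ 1 := by
  rw [moves_sub_laps x T hω, abs_le]
  split_ifs <;> norm_num

/-- Every node gets its share `T / (2 S)` of the time up to deviations: by `abs_moves_sub_laps_le` all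
nodes have the same number of departures, and the visits of all nodes add up to `T`. -/
lemma visits_bounds {p : Fin S × Fin 2 → X → ℝ} {θ θ' : ℝ}
    (hθ : ∀ x a, θ ≤ p x a) (hθ' : ∀ x a, p x a ≤ θ')
    (x : Fin S × Fin 2) (T : ℕ) {ω : ℕ → (Fin S × Fin 2) × X}
    (hω : ∀ t, (ω (t + 1)).1 = (ω t).1 ∨ (ω (t + 1)).1 = next (ω t).1) :
    θ * visits x T ω ≤ θ' * T / (2 * S) + 2 + (∑ y, |deviation p y T ω|) / (2 * S) +
        |deviation p x T ω| ∧
      θ * T / (2 * S) - 2 - (∑ y, |deviation p y T ω|) / (2 * S) - |deviation p x T ω| ≤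
        θ' * visits x T ω := by
  have hS : (0 : ℝ) < 2 * S := by
    have := Nat.pos_of_neZero S
    positivity
  have hlow : ∀ y, θ * visits y T ω ≤ laps T ω + 1 + |deviation p y T ω| := fun y => by
    have h1 := (mul_visits_le hθ hθ' y T ω).1
    have h2 := (abs_le.1 (abs_moves_sub_laps_le y T hω)).2
    have h3 := neg_abs_le (deviation p y T ω)
    linarith
  have hupp : ∀ y, laps T ω - 1 - |deviation p y T ω| ≤ θ' * visits y T ω := fun y => by
    have h1 := (mul_visits_le hθ hθ' y T ω).2
    have h2 := (abs_le.1 (abs_moves_sub_laps_le y T hω)).1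
    have h3 := le_abs_self (deviation p y T ω)
    linarith
  have hcard : (Finset.univ : Finset (Fin S × Fin 2)).card = 2 * S := by simp [mul_comm]
  have s1 := Finset.sum_le_sum fun y (_ : y ∈ Finset.univ) => hlow y
  have s2 := Finset.sum_le_sum fun y (_ : y ∈ Finset.univ) => hupp y
  rw [← Finset.mul_sum, sum_visits, Finset.sum_add_distrib, Finset.sum_const, hcard,
    nsmul_eq_mul] at s1
  rw [← Finset.mul_sum, sum_visits, Finset.sum_sub_distrib, Finset.sum_const, hcard,
    nsmul_eq_mul] at s2
  push_cast at s1 s2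
  have e1 : laps T ω - 1 ≤ (θ' * T + ∑ y, |deviation p y T ω|) / (2 * S) := by
    rw [le_div_iff₀ hS]; linarith
  have e2 : (θ * T - ∑ y, |deviation p y T ω|) / (2 * S) ≤ laps T ω + 1 := by
    rw [div_le_iff₀ hS]; linarith
  rw [add_div] at e1
  rw [sub_div] at e2
  exact ⟨by linarith [hlow x], by linarith [hupp x]⟩

end DiscountedMDP

/-! ### Visit counts in expectation -/

namespace DiscountedMDP

lemma dependsOn_sum_steps {X : Type} (g : X → X → ℝ) (T : ℕ) :
    DependsOn (fun ω : ℕ → X => ∑ t ∈ Finset.range T, g (ω t) (ω (t + 1))) (Set.Iic T) :=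
  fun x y hxy => Finset.sum_congr rfl fun t ht => by
    have := Finset.mem_range.1 ht
    rw [hxy t (Set.mem_Iic.2 this.le), hxy (t + 1) (Set.mem_Iic.2 this)]

lemma dependsOn_visits {S : ℕ} {X : Type} (x : Fin S × Fin 2) (T : ℕ) :
    DependsOn (visits (X := X) x T) (Set.Iic T) :=
  dependsOn_sum_steps (fun (z _ : (Fin S × Fin 2) × X) => if z.1 = x then 1 else 0) T

lemma dependsOn_deviation {S : ℕ} {X : Type} (p : Fin S × Fin 2 → X → ℝ) (x : Fin S × Fin 2)
    (T : ℕ) : DependsOn (deviation p x T) (Set.Iic T) :=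
  dependsOn_sum_steps (fun z z' : (Fin S × Fin 2) × X =>
    if z.1 = x then (if z'.1 = x then 0 else 1) - p z.1 z.2 else 0) T

lemma visits_nonneg {S : ℕ} {X : Type} (x : Fin S × Fin 2) (T : ℕ)
    (ω : ℕ → (Fin S × Fin 2) × X) : 0 ≤ visits x T ω :=
  Finset.sum_nonneg fun _ _ => by split_ifs <;> norm_num

variable {S A : ℕ} [NeZero S] {γ : ℝ} {hγ0 : 0 < γ} {hγ1 : γ < 1}
  {p : Fin S × Fin 2 → Fin A → ℝ} {hp : ∀ x a, p x a ∈ Set.Icc (0 : ℝ) 1}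

lemma ae_step_eq_or_eq_next (π : Policy (Fin S × Fin 2) (Fin A)) (s : Fin S × Fin 2) :
    ∀ᵐ ω ∂((ringMDP γ hγ0 hγ1 p hp).law π s),
      ∀ t, (ω (t + 1)).1 = (ω t).1 ∨ (ω (t + 1)).1 = next (ω t).1 := by
  filter_upwards [(ringMDP γ hγ0 hγ1 p hp).ae_trans_ne_zero π s] with ω hω t
  exact eq_or_eq_next_of_trans_ne_zero (hω t)

/-- The deviations form a martingale whose conditional variances are at most `θ'` per visit. -/
lemma integral_deviation_sq_le {θ' : ℝ} (hθ' : ∀ x a, p x a ≤ θ')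
    (π : Policy (Fin S × Fin 2) (Fin A)) (s x : Fin S × Fin 2) (T : ℕ) :
    ∫ ω, deviation p x T ω ^ 2 ∂((ringMDP γ hγ0 hγ1 p hp).law π s) ≤
      θ' * ∫ ω, visits x T ω ∂((ringMDP γ hγ0 hγ1 p hp).law π s) := by
  set M := ringMDP γ hγ0 hγ1 p hp with hM
  induction T with
  | zero => simp [deviation, visits]
  | succ T ih =>
    let d : (Fin S × Fin 2) × Fin A → Fin S × Fin 2 → ℝ := fun z s' =>
      if z.1 = x then (if s' = x then 0 else 1) - p z.1 z.2 else 0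
    have hdev : ∀ ω : ℕ → (Fin S × Fin 2) × Fin A, deviation p x (T + 1) ω =
        deviation p x T ω + d (ω T) (ω (T + 1)).1 := fun ω => Finset.sum_range_succ _ _
    have hvis : ∀ ω : ℕ → (Fin S × Fin 2) × Fin A, visits x (T + 1) ω =
        visits x T ω + if (ω T).1 = x then 1 else 0 := fun ω => Finset.sum_range_succ _ _
    have hD : DependsOn (deviation p x T) (Set.Iic T) := dependsOn_deviation p x T
    have hpair : ∀ f : (Fin S × Fin 2) × Fin A → (Fin S × Fin 2) × Fin A → ℝ,
        DependsOn (fun ω : ℕ → (Fin S × Fin 2) × Fin A => f (ω T) (ω (T + 1)))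
          (Set.Iic (T + 1)) := fun f y z hyz => by
      simp only
      rw [hyz T (Set.mem_Iic.2 (Nat.le_succ T)), hyz (T + 1) (Set.mem_Iic.2 le_rfl)]
    have h1 : ∫ ω, 2 * deviation p x T ω * d (ω T) (ω (T + 1)).1 ∂(M.law π s) = 0 := by
      have := M.integral_mul_nextState π (Nat.zero_le T) Fin.elim0 s
        (F := fun ω => 2 * deviation p x T ω) (fun y z hyz => by simp only [hD hyz]) d
      rw [law, this]
      refine integral_eq_zero_of_ae (Filter.Eventually.of_forall fun ω => ?_)
      have hz : ∑ s', (M.trans (ω T).1 (ω T).2 s').toReal * d (ω T) s' = 0 := by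
        simp only [hM, toReal_trans_ringMDP, sum_ringProb_mul, d]
        by_cases hx : (ω T).1 = x
        · simp [hx, next_ne, mul_comm]
        · simp [hx]
      simp [hz]
    have h2 : ∫ ω, d (ω T) (ω (T + 1)).1 ^ 2 ∂(M.law π s) ≤
        ∫ ω, θ' * (if (ω T).1 = x then 1 else 0) ∂(M.law π s) := by
      have := M.integral_mul_nextState π (Nat.zero_le T) Fin.elim0 s
        (F := fun _ => 1) (fun _ _ _ => rfl) (fun z s' => d z s' ^ 2)
      simp only [one_mul] at this
      rw [law, this]
      refine integral_mono (integrable_eval _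
        (fun z => ∑ s', (M.trans z.1 z.2 s').toReal * d z s' ^ 2) _)
        (integrable_eval _ (fun z => θ' * if z.1 = x then 1 else 0) _) fun ω => ?_
      simp only [hM, toReal_trans_ringMDP, sum_ringProb_mul, d]
      by_cases hx : (ω T).1 = x
      · simp only [hx, next_ne, if_true, if_false]
        have h3 := hp x (ω T).2
        have h4 := hθ' x (ω T).2
        nlinarith [h3.1, h3.2, mul_nonneg h3.1 h3.1]
      · simp [hx]
    have i1 : Integrable (fun ω => deviation p x T ω ^ 2) (M.law π s) :=
      integrable_of_dependsOn (n := T) (fun y z hyz => by simp only [hD hyz]) _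
    have i2 : Integrable (fun ω => 2 * deviation p x T ω * d (ω T) (ω (T + 1)).1)
        (M.law π s) :=
      integrable_of_dependsOn (n := T + 1) (fun y z hyz => by
        have ha := hD fun i hi => hyz i (le_trans hi (Nat.le_succ T))
        have hb := hpair (fun u v => d u v.1) hyz
        simp only at hb
        simp only [ha, hb]) _
    have i3 : Integrable (fun ω => d (ω T) (ω (T + 1)).1 ^ 2) (M.law π s) :=
      integrable_of_dependsOn (hpair fun u v => d u v.1 ^ 2) _
    have i4 : Integrable (visits x T) (M.law π s) :=
      integrable_of_dependsOn (dependsOn_visits x T) _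
    have i5 : Integrable (fun ω : ℕ → (Fin S × Fin 2) × Fin A =>
        if (ω T).1 = x then (1 : ℝ) else 0) (M.law π s) :=
      integrable_eval _ (fun z => if z.1 = x then (1 : ℝ) else 0) _
    have e1 : ∀ ω : ℕ → (Fin S × Fin 2) × Fin A, deviation p x (T + 1) ω ^ 2 =
        deviation p x T ω ^ 2 + 2 * deviation p x T ω * d (ω T) (ω (T + 1)).1 +
          d (ω T) (ω (T + 1)).1 ^ 2 := fun ω => by rw [hdev]; ring
    simp only [e1, hvis]
    have i12 : Integrable (fun ω => deviation p x T ω ^ 2 +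
        2 * deviation p x T ω * d (ω T) (ω (T + 1)).1) (M.law π s) := i1.add i2
    rw [integral_add i12 i3, integral_add i1 i2, integral_add i4 i5, h1]
    rw [integral_const_mul] at h2
    linarith

/-- The bound is linear in the visits, by `|d| ≤ d ^ 2 / 200 + 50`; this costs only a small fraction of
the expected departures, and the constant is of lower order. -/
lemma integral_abs_deviation_le {θ' : ℝ} (hθ' : ∀ x a, p x a ≤ θ')
    (π : Policy (Fin S × Fin 2) (Fin A)) (s x : Fin S × Fin 2) (T : ℕ) :
    ∫ ω, |deviation p x T ω| ∂((ringMDP γ hγ0 hγ1 p hp).law π s) ≤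
      θ' / 200 * (∫ ω, visits x T ω ∂((ringMDP γ hγ0 hγ1 p hp).law π s)) + 50 := by
  have hD : DependsOn (deviation p x T) (Set.Iic T) := dependsOn_deviation p x T
  have i1 : Integrable (fun ω => deviation p x T ω ^ 2 / 200)
      ((ringMDP γ hγ0 hγ1 p hp).law π s) :=
    integrable_of_dependsOn (n := T) (fun y z hyz => by simp only [hD hyz]) _
  calc ∫ ω, |deviation p x T ω| ∂((ringMDP γ hγ0 hγ1 p hp).law π s)
      ≤ ∫ ω, (deviation p x T ω ^ 2 / 200 + 50) ∂((ringMDP γ hγ0 hγ1 p hp).law π s) := by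
        refine integral_mono (integrable_of_dependsOn (n := T)
          (fun y z hyz => by simp only [hD hyz]) _) (i1.add (integrable_const _)) fun ω => ?_
        simp only
        nlinarith [sq_nonneg (|deviation p x T ω| - 100), sq_abs (deviation p x T ω)]
    _ = (∫ ω, deviation p x T ω ^ 2 ∂((ringMDP γ hγ0 hγ1 p hp).law π s)) / 200 + 50 := by
        rw [integral_add i1 (integrable_const _), integral_div]
        simp
    _ ≤ _ := by
        have := integral_deviation_sq_le (hγ0 := hγ0) (hγ1 := hγ1) (hp := hp) hθ' π s x T
        linarith

lemma integrable_visits (π : Policy (Fin S × Fin 2) (Fin A)) (s x : Fin S × Fin 2) (T : ℕ) :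
    Integrable (visits x T) ((ringMDP γ hγ0 hγ1 p hp).law π s) :=
  integrable_of_dependsOn (dependsOn_visits x T) _

lemma integrable_abs_deviation (π : Policy (Fin S × Fin 2) (Fin A)) (s x : Fin S × Fin 2)
    (T : ℕ) :
    Integrable (fun ω => |deviation p x T ω|) ((ringMDP γ hγ0 hγ1 p hp).law π s) :=
  integrable_of_dependsOn (n := T) (fun y z hyz => by
    have hD : DependsOn (deviation p x T) (Set.Iic T) := dependsOn_deviation p x T
    simp only [hD hyz]) _

lemma integral_sum_abs_deviation_le {θ' : ℝ} (hθ' : ∀ x a, p x a ≤ θ')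
    (π : Policy (Fin S × Fin 2) (Fin A)) (s : Fin S × Fin 2) (T : ℕ) :
    ∫ ω, ∑ x, |deviation p x T ω| ∂((ringMDP γ hγ0 hγ1 p hp).law π s) ≤
      θ' / 200 * T + 100 * S := by
  rw [integral_finsetSum _ fun x _ => integrable_abs_deviation π s x T]
  refine (Finset.sum_le_sum fun x _ => integral_abs_deviation_le hθ' π s x T).trans ?_
  rw [Finset.sum_add_distrib, ← Finset.mul_sum,
    ← integral_finsetSum _ fun x _ => integrable_visits π s x T]
  simp only [sum_visits]
  simp
  linarith

/-- No node is visited much more often than the average of `T / (2 S)` times. -/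
lemma integral_visits_le {θ θ' : ℝ} (hθ0 : 0 < θ) (hθ : ∀ x a, θ ≤ p x a)
    (hθ' : ∀ x a, p x a ≤ θ') (hθθ' : θ' ≤ 3 / 2 * θ) {T : ℕ} (hT : 10 ^ 7 * S ≤ θ * T)
    (π : Policy (Fin S × Fin 2) (Fin A)) (s x : Fin S × Fin 2) :
    ∫ ω, visits x T ω ∂((ringMDP γ hγ0 hγ1 p hp).law π s) ≤ T / S := by
  have hS : (0 : ℝ) < S := by exact_mod_cast Nat.pos_of_neZero S
  set μ := (ringMDP γ hγ0 hγ1 p hp).law π s with hμ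
  have i1 : Integrable (fun ω => |deviation p x T ω|) μ := integrable_abs_deviation π s x T
  have i2 : Integrable (fun ω => ∑ y, |deviation p y T ω|) μ :=
    integrable_finsetSum _ fun y _ => integrable_abs_deviation π s y T
  have h1 : ∫ ω, θ * visits x T ω ∂μ ≤ ∫ ω, (θ' * T / (2 * S) + 2 +
      (∑ y, |deviation p y T ω|) / (2 * S) + |deviation p x T ω|) ∂μ := by
    refine integral_mono_ae ((integrable_visits π s x T).const_mul θ)
      (((integrable_const _).add (i2.div_const (2 * (S : ℝ)))).add i1) ?_
    filter_upwards [ae_step_eq_or_eq_next (γ := γ) (hγ0 := hγ0) (hγ1 := hγ1) (hp := hp) π s]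
      with ω hω
    exact (visits_bounds hθ hθ' x T hω).1
  have i3 : Integrable (fun ω => θ' * T / (2 * S) + 2 +
      (∑ y, |deviation p y T ω|) / (2 * S)) μ := (integrable_const _).add (i2.div_const _)
  rw [integral_const_mul, integral_add i3 i1,
    integral_add (integrable_const _) (i2.div_const _), integral_div] at h1
  simp only [integral_const, probReal_univ, one_smul] at h1
  have h2 := integral_sum_abs_deviation_le (hγ0 := hγ0) (hγ1 := hγ1) (hp := hp) hθ' π s T
  have h3 := integral_abs_deviation_le (hγ0 := hγ0) (hγ1 := hγ1) (hp := hp) hθ' π s x T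
  rw [← hμ] at h2 h3
  have hN : 0 ≤ ∫ ω, visits x T ω ∂μ := integral_nonneg fun ω => visits_nonneg x T ω
  set N := ∫ ω, visits x T ω ∂μ
  set Q := ∫ ω, ∑ y, |deviation p y T ω| ∂μ
  have hT0 : (0 : ℝ) ≤ T := Nat.cast_nonneg T
  have h4 : Q / (2 * S) ≤ (3 / 2 * θ / 200 * T + 100 * S) / (2 * S) := by
    gcongr
    refine h2.trans ?_
    gcongr
  have h5 : θ' * T / (2 * S) ≤ 3 / 2 * θ * T / (2 * S) := by gcongr
  have h6 : θ' / 200 * N ≤ 3 / 2 * θ / 200 * N := by gcongr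
  have e1 : (3 / 2 * θ / 200 * T + 100 * S) / (2 * S) = 3 / 800 * (θ * T / S) + 50 := by
    field_simp; ring
  have e2 : 3 / 2 * θ * T / (2 * S) = 3 / 4 * (θ * T / S) := by field_simp; ring
  have h7 : (10 : ℝ) ^ 7 ≤ θ * T / S := by rw [le_div_iff₀ hS]; exact hT
  have h8 : θ * N ≤ θ * (T / S) := by
    rw [← mul_div_assoc]
    linarith
  exact le_of_mul_le_mul_left h8 hθ0

/-- Truncated at `K = T / (10 S)`, which is a fifth of the long-run average, the visits to the nodes
`(i, 0)` still add up to most of `S K = T / 10`, as the fluctuations are of lower order. -/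
lemma integral_sum_min_visits_ge {θ θ' : ℝ} (hθ0 : 0 < θ) (hθ : ∀ x a, θ ≤ p x a)
    (hθ' : ∀ x a, p x a ≤ θ') (hθθ' : θ' ≤ 3 / 2 * θ) {T : ℕ} (hT : 10 ^ 7 * S ≤ θ * T)
    (π : Policy (Fin S × Fin 2) (Fin A)) (s : Fin S × Fin 2) :
    17 / 200 * (T : ℝ) ≤ ∫ ω, ∑ i : Fin S, min (visits (i, 0) T ω) (T / (10 * S))
      ∂((ringMDP γ hγ0 hγ1 p hp).law π s) := by
  have hS : (0 : ℝ) < S := by exact_mod_cast Nat.pos_of_neZero S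
  have hT0 : (0 : ℝ) ≤ T := Nat.cast_nonneg T
  set μ := (ringMDP γ hγ0 hγ1 p hp).law π s with hμ
  have i2 : Integrable (fun ω => ∑ y, |deviation p y T ω|) μ :=
    integrable_finsetSum _ fun y _ => integrable_abs_deviation π s y T
  have hdep : DependsOn (fun ω : ℕ → (Fin S × Fin 2) × Fin A =>
      ∑ i : Fin S, min (visits (i, 0) T ω) (T / (10 * S))) (Set.Iic T) := fun y z hyz => by
    refine Finset.sum_congr rfl fun i _ => ?_
    rw [dependsOn_visits (i, 0) T hyz]
  have hθθ : θ ≤ θ' := (hθ (0, 0) ⟨0, by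
    by_contra h
    have hA : A = 0 := by omega
    subst hA
    exact (π 0 Fin.elim0 s).support_nonempty.elim fun a _ => a.elim0⟩).trans (hθ' _ _)
  have hθ'0 : 0 < θ' := hθ0.trans_le hθθ
  have h1 : ∫ ω, (T / 10 - (2 * S + 3 / 2 * ∑ y, |deviation p y T ω|) / θ) ∂μ ≤
      ∫ ω, ∑ i : Fin S, min (visits (i, 0) T ω) (T / (10 * S)) ∂μ := by
    refine integral_mono_ae ((integrable_const _).sub
      (((integrable_const _).add (i2.const_mul _)).div_const _))
      (integrable_of_dependsOn hdep μ) ?_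
    filter_upwards [ae_step_eq_or_eq_next (γ := γ) (hγ0 := hγ0) (hγ1 := hγ1) (hp := hp) π s]
      with ω hω
    set Q := ∑ y, |deviation p y T ω| with hQ
    have hQ0 : 0 ≤ Q := Finset.sum_nonneg fun _ _ => abs_nonneg _
    have hmin : ∀ i : Fin S, (T : ℝ) / (10 * S) -
        (2 + Q / (2 * S) + |deviation p (i, 0) T ω|) / θ ≤
        min (visits (i, 0) T ω) (T / (10 * S)) := by
      intro i
      have hR : 0 ≤ 2 + Q / (2 * S) + |deviation p (i, 0) T ω| := by positivity
      refine le_min ?_ (sub_le_self _ (by positivity))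
      have h2 := (visits_bounds hθ hθ' (i, 0) T hω).2
      rw [← hQ] at h2
      have h3 : θ' * (T / (10 * S)) ≤ θ * T / (2 * S) := by
        have : θ * T / (2 * S) = 5 * θ * (T / (10 * S)) := by field_simp; ring
        rw [this]
        gcongr
        linarith
      have h4 : 2 + Q / (2 * S) + |deviation p (i, 0) T ω| ≤
          θ' * ((2 + Q / (2 * S) + |deviation p (i, 0) T ω|) / θ) := by
        rw [← mul_div_assoc, le_div_iff₀ hθ0, mul_comm]
        gcongr
      refine le_of_mul_le_mul_left ?_ hθ'0
      rw [mul_sub]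
      linarith
    refine le_trans ?_ (Finset.sum_le_sum fun i _ => hmin i)
    have h5 : ∑ i : Fin S, |deviation p (i, 0) T ω| ≤ Q := by
      rw [hQ, Fintype.sum_prod_type]
      refine Finset.sum_le_sum fun i _ => ?_
      exact Finset.single_le_sum (f := fun b => |deviation p (i, b) T ω|)
        (fun _ _ => abs_nonneg _) (Finset.mem_univ 0)
    have e0 : ∑ i : Fin S, ((T : ℝ) / (10 * S) -
        (2 + Q / (2 * S) + |deviation p (i, 0) T ω|) / θ) =
        T / 10 - (2 * S + Q / 2 + ∑ i : Fin S, |deviation p (i, 0) T ω|) / θ := by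
      rw [Finset.sum_sub_distrib, ← Finset.sum_div Finset.univ
        (fun i : Fin S => 2 + Q / (2 * S) + |deviation p (i, 0) T ω|), Finset.sum_add_distrib]
      simp only [Finset.sum_const, Finset.card_univ, Fintype.card_fin, nsmul_eq_mul]
      have e1 : (S : ℝ) * (T / (10 * S)) = T / 10 := by field_simp
      have e2 : (S : ℝ) * (2 + Q / (2 * S)) = 2 * S + Q / 2 := by field_simp
      rw [e1, e2]
    rw [e0]
    refine sub_le_sub_left (div_le_div_of_nonneg_right ?_ hθ0.le) _
    linarith
  refine le_trans ?_ h1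
  have i3 : Integrable (fun ω => (2 * S + 3 / 2 * ∑ y, |deviation p y T ω|) / θ) μ :=
    ((integrable_const _).add (i2.const_mul _)).div_const _
  rw [integral_sub (integrable_const _) i3,
    integral_div θ (fun ω => 2 * (S : ℝ) + 3 / 2 * ∑ y, |deviation p y T ω|),
    integral_add (integrable_const _) (i2.const_mul _),
    integral_const_mul (3 / 2 : ℝ) fun ω => ∑ y, |deviation p y T ω|]
  simp only [integral_const, probReal_univ, one_smul]
  have h2 := integral_sum_abs_deviation_le (hγ0 := hγ0) (hγ1 := hγ1) (hp := hp) hθ' π s T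
  rw [← hμ] at h2
  set Q := ∫ ω, ∑ y, |deviation p y T ω| ∂μ
  have h3 : Q ≤ 3 / 2 * θ / 200 * T + 100 * S := h2.trans (by gcongr)
  have h4 : (2 * S + 3 / 2 * Q) / θ ≤ 3 / 200 * T := by
    rw [div_le_iff₀ hθ0]
    nlinarith
  linarith

end DiscountedMDP

/-! ### Change of measure between rings that differ in a single action -/

namespace DiscountedMDP

/-- The number of times the action `z.2` is played in the node `z.1` before time `T`. -/
def pulls {S A : ℕ} (z : (Fin S × Fin 2) × Fin A) (T : ℕ)
    (ω : ℕ → (Fin S × Fin 2) × Fin A) : ℝ :=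
  ∑ t ∈ Finset.range T, if ω t = z then 1 else 0

lemma dependsOn_pulls {S A : ℕ} (z : (Fin S × Fin 2) × Fin A) (T : ℕ) :
    DependsOn (pulls z T) (Set.Iic T) :=
  dependsOn_sum_steps (fun z' (_ : (Fin S × Fin 2) × Fin A) => if z' = z then 1 else 0) T

lemma pulls_nonneg {S A : ℕ} (z : (Fin S × Fin 2) × Fin A) (T : ℕ)
    (ω : ℕ → (Fin S × Fin 2) × Fin A) : 0 ≤ pulls z T ω :=
  Finset.sum_nonneg fun _ _ => by split_ifs <;> norm_num

lemma sum_pulls {S A : ℕ} (x : Fin S × Fin 2) (T : ℕ) (ω : ℕ → (Fin S × Fin 2) × Fin A) :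
    ∑ a, pulls (x, a) T ω = visits x T ω := by
  simp only [pulls, visits]
  rw [Finset.sum_comm]
  refine Finset.sum_congr rfl fun t _ => ?_
  by_cases h : (ω t).1 = x <;> simp [Prod.ext_iff, h]

lemma pulls_le_visits {S A : ℕ} (z : (Fin S × Fin 2) × Fin A) (T : ℕ)
    (ω : ℕ → (Fin S × Fin 2) × Fin A) : pulls z T ω ≤ visits z.1 T ω := by
  rw [← sum_pulls]
  exact Finset.single_le_sum (f := fun a => pulls (z.1, a) T ω) (fun a _ => pulls_nonneg _ _ _)
    (Finset.mem_univ z.2)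

/-- The indicator of the event that `z` is pulled at most `m` times before time `T`. -/
def fewPulls {S A : ℕ} (z : (Fin S × Fin 2) × Fin A) (T : ℕ) (m : ℝ)
    (ω : ℕ → (Fin S × Fin 2) × Fin A) : ℝ :=
  if pulls z T ω ≤ m then 1 else 0

lemma dependsOn_fewPulls {S A : ℕ} (z : (Fin S × Fin 2) × Fin A) (T : ℕ) (m : ℝ) :
    DependsOn (fewPulls z T m) (Set.Iic T) := fun x y hxy => by
  simp only [fewPulls, dependsOn_pulls z T hxy]

/-- Few actions can be pulled often, by Markov's inequality: the pulls of all actions add up to the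
visits of the node. -/
lemma sum_integral_fewPulls_ge {S A : ℕ} (M : DiscountedMDP (Fin S × Fin 2) (Fin A))
    (π : Policy (Fin S × Fin 2) (Fin A)) (s x : Fin S × Fin 2) (T : ℕ) {m : ℝ} (hm : 0 < m) :
    A - (∫ ω, visits x T ω ∂(M.law π s)) / m ≤
      ∑ a, ∫ ω, fewPulls (x, a) T m ω ∂(M.law π s) := by
  have i1 : ∀ a, Integrable (fun ω => pulls (x, a) T ω) (M.law π s) :=
    fun a => integrable_of_dependsOn (dependsOn_pulls _ T) _
  have h1 : ∀ a, 1 - (∫ ω, pulls (x, a) T ω ∂(M.law π s)) / m ≤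
      ∫ ω, fewPulls (x, a) T m ω ∂(M.law π s) := by
    intro a
    have e1 : ∫ ω, (1 - pulls (x, a) T ω / m) ∂(M.law π s) =
        1 - (∫ ω, pulls (x, a) T ω ∂(M.law π s)) / m := by
      rw [integral_sub (integrable_const _) ((i1 a).div_const m), integral_div]
      simp
    rw [← e1]
    refine integral_mono ((integrable_const _).sub ((i1 a).div_const m))
      (integrable_of_dependsOn (dependsOn_fewPulls _ T m) _) fun ω => ?_
    simp only [fewPulls]
    have h0 := pulls_nonneg (x, a) T ω
    split_ifs with h
    · have : 0 ≤ pulls (x, a) T ω / m := by positivity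
      linarith
    · have : 1 ≤ pulls (x, a) T ω / m := by
        rw [one_le_div hm]
        exact (not_le.1 h).le
      linarith
  refine le_trans (le_of_eq ?_) (Finset.sum_le_sum fun a _ => h1 a)
  rw [Finset.sum_sub_distrib, ← Finset.sum_div, ← integral_finsetSum _ fun a _ => i1 a]
  simp only [sum_pulls]
  simp

variable {S A : ℕ} [NeZero S] {γ : ℝ} {hγ0 : 0 < γ} {hγ1 : γ < 1}

/-- The likelihood ratio of a single transition between two rings which leave `z.1` under the action
`z.2` with probabilities `u` and `w`, multiplied by `k` when `z.2` is played in `z.1`. -/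
def ratio (z : (Fin S × Fin 2) × Fin A) (u w k : ℝ) (x : Fin S × Fin 2) (a : Fin A)
    (y : Fin S × Fin 2) : ℝ :=
  if (x, a) = z then k * (if y = next x then w / u else (1 - w) / (1 - u)) else 1

lemma ratio_pos {z : (Fin S × Fin 2) × Fin A} {u w k : ℝ} (hu : u ∈ Set.Ioo (0 : ℝ) 1)
    (hw : w ∈ Set.Ioo (0 : ℝ) 1) (hk : 0 < k) (x : Fin S × Fin 2) (a : Fin A)
    (y : Fin S × Fin 2) : 0 < ratio z u w k x a y := by
  have h1 := hu.1
  have h2 := hw.1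
  have h3 : 0 < 1 - u := by linarith [hu.2]
  have h4 : 0 < 1 - w := by linarith [hw.2]
  rw [ratio]
  split_ifs <;> positivity

/-- If two rings differ only in the pair `z`, and `exp y` bounds the factor by which a pull of `z`
multiplies the second moment of the likelihood ratio, then few pulls of `z` in one ring make few
pulls of `z` likely in the other one. With `L` the likelihood ratio of the two laws, this combines
`L + 1 / L ≥ 2` with the fact that `1 / L`, suitably discounted at each pull, is again the
likelihood ratio of a ring. -/
lemma integral_fewPulls_ge {p p' : Fin S × Fin 2 → Fin A → ℝ}
    {hp : ∀ x a, p x a ∈ Set.Icc (0 : ℝ) 1} {hp' : ∀ x a, p' x a ∈ Set.Icc (0 : ℝ) 1}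
    (z : (Fin S × Fin 2) × Fin A) (hne : ∀ x a, (x, a) ≠ z → p' x a = p x a)
    {u w y : ℝ} (hu : p z.1 z.2 = u) (hw : p' z.1 z.2 = w) (hu' : u ∈ Set.Ioo (0 : ℝ) 1)
    (hw' : w ∈ Set.Ioo (0 : ℝ) 1) (hy : u ^ 2 / w + (1 - u) ^ 2 / (1 - w) ≤ Real.exp y) (hy0 : 0 ≤ y)
    (π : Policy (Fin S × Fin 2) (Fin A)) (s : Fin S × Fin 2) (T : ℕ) (m : ℝ) :
    2 * ∫ ω, fewPulls z T m ω ∂((ringMDP γ hγ0 hγ1 p hp).law π s) - Real.exp (y * m) ≤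
      ∫ ω, fewPulls z T m ω ∂((ringMDP γ hγ0 hγ1 p' hp').law π s) := by
  have hu0 := hu'.1
  have hw0 := hw'.1
  have hu1 : 0 < 1 - u := by linarith [hu'.2]
  have hw1 : 0 < 1 - w := by linarith [hw'.2]
  set c : ℝ := u ^ 2 / w + (1 - u) ^ 2 / (1 - w) with hc
  have hc0 : 0 < c := by positivity
  -- the ring `q` has the transition probabilities `p ^ 2 / p'` at `z`, normalized by `c`
  let q : Fin S × Fin 2 → Fin A → ℝ := fun x a => if (x, a) = z then u ^ 2 / w / c else p x a
  have hq : ∀ x a, q x a ∈ Set.Icc (0 : ℝ) 1 := by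
    intro x a
    simp only [q]
    split_ifs
    · refine ⟨by positivity, ?_⟩
      rw [div_le_one hc0, hc]
      have : 0 ≤ (1 - u) ^ 2 / (1 - w) := by positivity
      linarith
    · exact hp x a
  have hq1 : 1 - u ^ 2 / w / c = (1 - u) * (c⁻¹ * ((1 - u) / (1 - w))) := by
    have h1 : c - u ^ 2 / w = (1 - u) ^ 2 / (1 - w) := by rw [hc]; ring
    calc 1 - u ^ 2 / w / c = (c - u ^ 2 / w) / c := by rw [sub_div, div_self hc0.ne']
      _ = _ := by rw [h1]; field_simp
  set M := ringMDP γ hγ0 hγ1 p hp with hM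
  set M' := ringMDP γ hγ0 hγ1 p' hp' with hM'
  set Mq := ringMDP γ hγ0 hγ1 q hq with hMq
  have hl : ∀ x a y, (M'.trans x a y).toReal = (M.trans x a y).toReal * ratio z u w 1 x a y := by
    intro x a y
    rw [hM, hM', toReal_trans_ringMDP, toReal_trans_ringMDP, ratio]
    by_cases hz : (x, a) = z
    · have h1 : p x a = u := by rw [← hu, ← hz]
      have h2 : p' x a = w := by rw [← hw, ← hz]
      rw [if_pos hz, h1, h2, one_mul, ringProb, ringProb]
      split_ifs
      · field_simp
      · field_simp
      · ring
    · rw [if_neg hz, mul_one, hne x a hz]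
  have hlq : ∀ x a y, (Mq.trans x a y).toReal =
      (M.trans x a y).toReal * ratio z w u c⁻¹ x a y := by
    intro x a y
    rw [hM, hMq, toReal_trans_ringMDP, toReal_trans_ringMDP, ratio]
    by_cases hz : (x, a) = z
    · have h1 : p x a = u := by rw [← hu, ← hz]
      have h2 : q x a = u ^ 2 / w / c := by simp only [q]; rw [if_pos hz]
      rw [if_pos hz, h1, h2, ringProb, ringProb]
      split_ifs
      · field_simp
      · exact hq1
      · ring
    · have h2 : q x a = p x a := by simp only [q]; rw [if_neg hz]
      rw [if_neg hz, mul_one, h2]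
  let L : (ℕ → (Fin S × Fin 2) × Fin A) → ℝ := fun ω =>
    ∏ t ∈ Finset.range T, ratio z u w 1 (ω t).1 (ω t).2 (ω (t + 1)).1
  let L' : (ℕ → (Fin S × Fin 2) × Fin A) → ℝ := fun ω =>
    ∏ t ∈ Finset.range T, ratio z w u c⁻¹ (ω t).1 (ω t).2 (ω (t + 1)).1
  have hE : DependsOn (fewPulls z T m) (Set.Iic T) := dependsOn_fewPulls z T m
  have e1 : ∫ ω, fewPulls z T m ω ∂(M'.law π s) = ∫ ω, fewPulls z T m ω * L ω ∂(M.law π s) :=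
    integral_law_eq_integral_mul_prod M M' π s _ hl hE
  have e2 : ∫ ω, fewPulls z T m ω ∂(Mq.law π s) = ∫ ω, fewPulls z T m ω * L' ω ∂(M.law π s) :=
    integral_law_eq_integral_mul_prod M Mq π s _ hlq hE
  have hprod : ∀ l : Fin S × Fin 2 → Fin A → Fin S × Fin 2 → ℝ,
      DependsOn (fun ω : ℕ → (Fin S × Fin 2) × Fin A => fewPulls z T m ω *
        ∏ t ∈ Finset.range T, l (ω t).1 (ω t).2 (ω (t + 1)).1) (Set.Iic T) := by
    intro l x y hxy
    simp only [hE hxy]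
    congr 1
    refine Finset.prod_congr rfl fun t ht => ?_
    have := Finset.mem_range.1 ht
    rw [hxy t (Set.mem_Iic.2 this.le), hxy (t + 1) this]
  have i1 : Integrable (fun ω => fewPulls z T m ω * L ω) (M.law π s) :=
    integrable_of_dependsOn (hprod _) _
  have i2 : Integrable (fun ω => fewPulls z T m ω * L' ω) (M.law π s) :=
    integrable_of_dependsOn (hprod _) _
  have hle : ∫ ω, fewPulls z T m ω ∂(Mq.law π s) ≤ 1 := by
    calc ∫ ω, fewPulls z T m ω ∂(Mq.law π s) ≤ ∫ _, (1 : ℝ) ∂(Mq.law π s) := by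
          refine integral_mono (integrable_of_dependsOn hE _) (integrable_const _) fun ω => ?_
          simp only [fewPulls]
          split_ifs <;> norm_num
      _ = 1 := by simp
  have hpt : ∀ ω, 2 * fewPulls z T m ω ≤
      fewPulls z T m ω * L ω + Real.exp (y * m) * (fewPulls z T m ω * L' ω) := by
    intro ω
    rw [fewPulls]
    split_ifs with hm
    · have hL : 0 < L ω := Finset.prod_pos fun t _ => ratio_pos hu' hw' one_pos _ _ _
      have hLL : Real.exp (-(y * pulls z T ω)) ≤ L ω * L' ω := by
        simp only [L, L', pulls]
        rw [← Finset.prod_mul_distrib, Finset.mul_sum, ← Finset.sum_neg_distrib, Real.exp_sum]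
        refine Finset.prod_le_prod (fun _ _ => (Real.exp_pos _).le) fun t _ => ?_
        simp only [ratio]
        by_cases hz : ω t = z
        · have hz' : ((ω t).1, (ω t).2) = z := hz
          rw [if_pos hz, if_pos hz', if_pos hz', mul_one, Real.exp_neg]
          have h3 : (Real.exp y)⁻¹ ≤ c⁻¹ := inv_anti₀ hc0 hy
          refine h3.trans (le_of_eq ?_)
          split_ifs <;> field_simp
        · have hz' : ¬ ((ω t).1, (ω t).2) = z := hz
          rw [if_neg hz, if_neg hz', if_neg hz']
          simp
      have h1 : Real.exp (-(y * m)) ≤ L ω * L' ω :=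
        (Real.exp_le_exp.2 (neg_le_neg (mul_le_mul_of_nonneg_left hm hy0))).trans hLL
      have h2 : 1 ≤ L ω * (Real.exp (y * m) * L' ω) := by
        calc (1 : ℝ) = Real.exp (y * m) * Real.exp (-(y * m)) := by
              rw [← Real.exp_add, add_neg_cancel, Real.exp_zero]
          _ ≤ Real.exp (y * m) * (L ω * L' ω) :=
              mul_le_mul_of_nonneg_left h1 (Real.exp_pos _).le
          _ = _ := by ring
      have h3 : 0 < Real.exp (y * m) * L' ω := by
        have : 0 < L' ω := Finset.prod_pos fun t _ => ratio_pos hw' hu' (inv_pos.2 hc0) _ _ _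
        positivity
      nlinarith [sq_nonneg (L ω - Real.exp (y * m) * L' ω)]
    · simp
  have hint := integral_mono ((integrable_of_dependsOn hE (M.law π s)).const_mul 2)
    (i1.add (i2.const_mul (Real.exp (y * m)))) hpt
  rw [integral_const_mul] at hint
  have e3 : ∫ ω, ((fun ω => fewPulls z T m ω * L ω) + fun ω =>
      Real.exp (y * m) * (fewPulls z T m ω * L' ω)) ω ∂(M.law π s) =
      ∫ ω, fewPulls z T m ω ∂(M'.law π s) +
        Real.exp (y * m) * ∫ ω, fewPulls z T m ω ∂(Mq.law π s) := by
    rw [e1, e2, ← integral_const_mul]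
    exact integral_add i1 (i2.const_mul _)
  rw [e3] at hint
  have := mul_le_mul_of_nonneg_left hle (Real.exp_pos (y * m)).le
  linarith

/-! ### Averaging over the optimal actions -/

/-- Resampling one coordinate leaves the uniform average over all functions unchanged. -/
lemma sum_sum_update {ι α : Type} [Fintype ι] [Fintype α] [DecidableEq ι] (G : (ι → α) → ℝ)
    (i : ι) : ∑ f, ∑ a, G (Function.update f i a) = Fintype.card α * ∑ f, G f := by
  -- `(f, a) ↦ (update f i a, f i)` is an involution
  have hinv : Function.Involutive fun x : (ι → α) × α => (Function.update x.1 i x.2, x.1 i) := by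
    rintro ⟨f, a⟩
    simp
  have h1 := Equiv.sum_comp hinv.toPerm fun x : (ι → α) × α => G x.1
  rw [Fintype.sum_prod_type, Fintype.sum_prod_type] at h1
  simp only [Function.Involutive.coe_toPerm, Finset.sum_const, Finset.card_univ,
    nsmul_eq_mul] at h1
  rw [h1, Finset.mul_sum]

/-- If resampling coordinate `i` makes `F · i` at least `c` on average, for every `i`, then some `f`
has `F f i` at least `c` on average over `i`. -/
lemma exists_sum_ge_of_sum_update_ge {ι α : Type} [Fintype ι] [Fintype α] [DecidableEq ι]
    [Nonempty α] (F : (ι → α) → ι → ℝ) (c : ℝ)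
    (hF : ∀ f i, c * Fintype.card α ≤ ∑ a, F (Function.update f i a) i) :
    ∃ f, c * Fintype.card ι ≤ ∑ i, F f i := by
  have hα : (0 : ℝ) < Fintype.card α := by exact_mod_cast Fintype.card_pos
  have h1 : ∀ i, ∑ _f : ι → α, c ≤ ∑ f, F f i := by
    intro i
    have h2 := Finset.sum_le_sum fun f (_ : f ∈ Finset.univ) => hF f i
    rw [sum_sum_update (fun f => F f i) i, ← Finset.sum_mul, mul_comm] at h2
    exact le_of_mul_le_mul_left h2 hα
  have h3 : ∑ _f : ι → α, c * Fintype.card ι ≤ ∑ f, ∑ i, F f i := by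
    rw [Finset.sum_comm]
    refine le_trans (le_of_eq ?_) (Finset.sum_le_sum fun i _ => h1 i)
    simp only [Finset.sum_const, nsmul_eq_mul, Finset.card_univ]
    ring
  obtain ⟨f, -, hf⟩ := Finset.exists_le_of_sum_le Finset.univ_nonempty h3
  exact ⟨f, hf⟩

end DiscountedMDP

/-! ### The hard instances -/

namespace DiscountedMDP

variable {S A : ℕ}

/-- The probabilities to leave a node of the hard ring: `θ`, increased by `ε` for the action `b i` in
the node `(i, 0)`. For `b i = none` no action is favoured in `(i, 0)`. -/
def moveProb (θ ε : ℝ) (b : Fin S → Option (Fin A)) (x : Fin S × Fin 2) (a : Fin A) : ℝ :=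
  if x.2 = 0 then θ + (if b x.1 = some a then ε else 0) else θ

lemma le_moveProb {θ ε : ℝ} (hε : 0 ≤ ε) (b : Fin S → Option (Fin A)) (x : Fin S × Fin 2)
    (a : Fin A) : θ ≤ moveProb θ ε b x a := by
  rw [moveProb]
  split_ifs <;> linarith

lemma moveProb_le {θ ε : ℝ} (hε : 0 ≤ ε) (b : Fin S → Option (Fin A)) (x : Fin S × Fin 2)
    (a : Fin A) : moveProb θ ε b x a ≤ θ + ε := by
  rw [moveProb]
  split_ifs <;> linarith

lemma moveProb_mem {θ ε : ℝ} (hθ : 0 ≤ θ) (hε : 0 ≤ ε) (h : θ + ε ≤ 1) (b : Fin S → Option (Fin A))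
    (x : Fin S × Fin 2) (a : Fin A) : moveProb θ ε b x a ∈ Set.Icc (0 : ℝ) 1 :=
  ⟨hθ.trans (le_moveProb hε b x a), (moveProb_le hε b x a).trans h⟩

variable {γ ε : ℝ}

/-- The difference of the optimal values of the nodes `(i, 1)` and `(i, 0)`. -/
def valueGap (γ ε : ℝ) : ℝ := 1 / (1 - γ + 2 * γ * (1 - γ) + γ * ε)

/-- The suboptimality gaps of the hard ring. -/
def ringGap (γ ε : ℝ) (f : Fin S → Fin A) (x : (Fin S × Fin 2) × Fin A) : ℝ :=
  if x.1.2 = 0 then (if x.2 = f x.1.1 then 0 else γ * ε * valueGap γ ε) else 0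

lemma valueGap_pos (hγ0 : 0 < γ) (hγ1 : γ < 1) (hε : 0 ≤ ε) : 0 < valueGap γ ε := by
  have : 0 < 1 - γ := by linarith
  rw [valueGap]
  positivity

lemma ringGap_nonneg (hγ0 : 0 < γ) (hγ1 : γ < 1) (hε : 0 ≤ ε) (f : Fin S → Fin A)
    (x : (Fin S × Fin 2) × Fin A) : 0 ≤ ringGap γ ε f x := by
  have := valueGap_pos hγ0 hγ1 hε
  rw [ringGap]
  split_ifs <;> positivity

lemma ringGap_le (hγ0 : 0 < γ) (hγ1 : γ < 1) (hε : 0 ≤ ε) (f : Fin S → Fin A)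
    (x : (Fin S × Fin 2) × Fin A) : ringGap γ ε f x ≤ γ * ε * valueGap γ ε := by
  have := valueGap_pos hγ0 hγ1 hε
  have : 0 ≤ γ * ε * valueGap γ ε := by positivity
  rw [ringGap]
  split_ifs <;> linarith

lemma ringGap_optimal (f : Fin S → Fin A) (x : Fin S × Fin 2) :
    ringGap γ ε f (x, f x.1) = 0 := by
  simp [ringGap]

lemma sum_ringGap (f : Fin S → Fin A) (T : ℕ) (ω : ℕ → (Fin S × Fin 2) × Fin A) :
    ∑ t ∈ Finset.range T, ringGap γ ε f (ω t) =
      γ * ε * valueGap γ ε * ∑ i, (visits (i, 0) T ω - pulls ((i, 0), f i) T ω) := by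
  simp only [visits, pulls, ← Finset.sum_sub_distrib]
  rw [Finset.sum_comm, Finset.mul_sum]
  refine Finset.sum_congr rfl fun t _ => ?_
  rw [Finset.sum_eq_single (ω t).1.1]
  · rw [ringGap]
    have h1 : (ω t).1 = ((ω t).1.1, 0) ↔ (ω t).1.2 = 0 := by
      rw [Prod.ext_iff]; simp
    have h2 : ω t = (((ω t).1.1, 0), f (ω t).1.1) ↔ (ω t).1.2 = 0 ∧ (ω t).2 = f (ω t).1.1 := by
      simp [Prod.ext_iff]
    simp only [h1, h2]
    by_cases hx : (ω t).1.2 = 0 <;> by_cases ha : (ω t).2 = f (ω t).1.1 <;> simp [hx, ha]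
  · intro i _ hi
    have h1 : ¬ (ω t).1 = (i, 0) := fun h => hi (by rw [h])
    have h2 : ¬ ω t = ((i, 0), f i) := fun h => h1 (by rw [h])
    simp [h1, h2]
  · simp

variable [NeZero S]

/-- The ring with favoured actions `b`. -/
def hardRing (γ ε : ℝ) (hγ0 : 0 < γ) (hγ1 : γ < 1) (hε : 0 ≤ ε) (hεγ : ε ≤ γ)
    (b : Fin S → Option (Fin A)) : DiscountedMDP (Fin S × Fin 2) (Fin A) :=
  ringMDP γ hγ0 hγ1 (moveProb (1 - γ) ε b)
    (moveProb_mem (by linarith) hε (by linarith) b)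

variable {hγ0 : 0 < γ} {hγ1 : γ < 1} {hε : 0 ≤ ε} {hεγ : ε ≤ γ}

lemma isHardRing_hardRing (f : Fin S → Fin A) :
    (hardRing γ ε hγ0 hγ1 hε hεγ fun i => some (f i)).IsHardRing γ ε f where
  discount_eq := rfl
  reward_zero _ _ := rfl
  reward_one _ _ := rfl
  trans_zero_one i a := by
    rw [hardRing, toReal_trans_ringMDP]
    simp [ringProb, next, moveProb, eq_comm]
  trans_zero_zero i a := by
    rw [hardRing, toReal_trans_ringMDP]
    simp only [ringProb, next, moveProb, Option.some_inj, eq_comm (b := a)]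
    simp
    ring
  trans_one_one i a := by
    rw [hardRing, toReal_trans_ringMDP]
    simp [ringProb, next, moveProb]
  trans_one_next i a := by
    rw [hardRing, toReal_trans_ringMDP]
    simp [ringProb, next, moveProb]

lemma hasGap_hardRing (f : Fin S → Fin A) :
    (hardRing γ ε hγ0 hγ1 hε hεγ fun i => some (f i)).HasGap
      (fun x => γ * (1 - γ + ε) * valueGap γ ε / (1 - γ) + if x.2 = 0 then 0 else valueGap γ ε)
      (ringGap γ ε f) := by
  have hθ : 0 < 1 - γ := by linarith
  have hδ : valueGap γ ε * (1 - γ + 2 * γ * (1 - γ) + γ * ε) = 1 := by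
    rw [valueGap]
    exact one_div_mul_cancel (by positivity)
  intro x a
  have hdisc : (hardRing γ ε hγ0 hγ1 hε hεγ fun i => some (f i)).discount = γ := rfl
  have hrew : (hardRing γ ε hγ0 hγ1 hε hεγ fun i => some (f i)).reward x a =
      if x.2 = 0 then 0 else 1 := rfl
  rw [hdisc, hrew]
  simp only [hardRing, toReal_trans_ringMDP, sum_ringProb_mul, ringGap]
  set δ := valueGap γ ε
  set v₀ := γ * (1 - γ + ε) * δ / (1 - γ) with hv
  have hv₀ : v₀ * (1 - γ) = γ * (1 - γ + ε) * δ := by rw [hv]; field_simp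
  by_cases hx : x.2 = 0
  · by_cases ha : a = f x.1
    · simp only [next, moveProb, hx, ha, if_true, one_ne_zero, if_false]
      linear_combination hv₀
    · have ha' : ¬ some (f x.1) = some a := fun h => ha (Option.some_inj.1 h).symm
      simp only [next, moveProb, hx, if_neg ha, if_neg ha', if_true, one_ne_zero, if_false]
      linear_combination hv₀
  · simp only [next, moveProb, hx, if_true, if_false]
    linear_combination hδ + hv₀

/-- For some choice of optimal actions, the expected number of suboptimal actions before time `T` is
linear in `T`. The condition on `ε` says `ε = √(A θ / K) / 24` with `K = T / (10 S)`, the largest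
order of magnitude at which `K / A` pulls do not reveal the optimal action. -/
lemma exists_suboptimal_ge {θ : ℝ} (hθ : θ = 1 - γ) (hγ : 2 / 3 ≤ γ) (hγ0 : 0 < γ) (hγ1 : γ < 1)
    (hε : 0 ≤ ε) (hεγ : ε ≤ γ)
    (hεθ : ε ≤ θ / 10) {T : ℕ} (hT : 10 ^ 7 * S ≤ θ * T) (hA : 1000 ≤ A)
    (hεA : ε ^ 2 * T * 576 = 10 * S * A * θ)
    (π : Policy (Fin S × Fin 2) (Fin A)) (s : Fin S × Fin 2) :
    ∃ f : Fin S → Fin A, (T : ℝ) / 50 ≤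
      ∫ ω, ∑ i, (visits (i, 0) T ω - pulls ((i, 0), f i) T ω)
        ∂((hardRing γ ε hγ0 hγ1 hε hεγ fun i => some (f i)).law π s) := by
  have hS : (0 : ℝ) < S := by exact_mod_cast Nat.pos_of_neZero S
  have hA' : (1000 : ℝ) ≤ A := by exact_mod_cast hA
  have hA0 : (0 : ℝ) < A := by linarith
  have hθ0 : 0 < θ := by linarith
  have hT0 : (0 : ℝ) < T := by
    by_contra! h
    nlinarith
  have : NeZero A := ⟨by omega⟩
  -- `m` is `50 K / A`, five times the average number of pulls per action that `T / S` visits allow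
  set m : ℝ := 5 * T / (S * A) with hm
  have hm0 : 0 < m := by positivity
  have hlow : ∀ b : Fin S → Option (Fin A), ∀ x a, θ ≤ moveProb (1 - γ) ε b x a :=
    fun b x a => hθ ▸ le_moveProb hε b x a
  have hupp : ∀ b : Fin S → Option (Fin A), ∀ x a, moveProb (1 - γ) ε b x a ≤ θ + ε :=
    fun b x a => hθ ▸ moveProb_le hε b x a
  have hup' : θ + ε ≤ 3 / 2 * θ := by linarith
  -- for each `i`, most choices of the favoured action in `(i, 0)` are rarely played
  have hfew : ∀ (f : Fin S → Fin A) (i : Fin S), 2 / 5 * (Fintype.card (Fin A) : ℝ) ≤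
      ∑ a, ∫ ω, fewPulls ((i, 0), Function.update f i a i) T m ω
        ∂((hardRing γ ε hγ0 hγ1 hε hεγ fun j => some (Function.update f i a j)).law π s) := by
    intro f i
    rw [Fintype.card_fin]
    let b₀ : Fin S → Option (Fin A) := Function.update (fun j => some (f j)) i none
    have hv : ∫ ω, visits (i, 0) T ω ∂((hardRing γ ε hγ0 hγ1 hε hεγ b₀).law π s) ≤ T / S :=
      integral_visits_le hθ0 (hlow b₀) (hupp b₀) hup' hT π s (i, 0)
    have h1 := sum_integral_fewPulls_ge (hardRing γ ε hγ0 hγ1 hε hεγ b₀) π s (i, 0) T hm0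
    have h2 : (∫ ω, visits (i, 0) T ω ∂((hardRing γ ε hγ0 hγ1 hε hεγ b₀).law π s)) / m ≤
        A / 5 := by
      rw [div_le_iff₀ hm0, hm]
      refine hv.trans (le_of_eq ?_)
      field_simp
    set y : ℝ := ε ^ 2 / (3 / 5 * θ) with hy
    have hy0 : 0 ≤ y := by positivity
    have hym : Real.exp (y * m) ≤ 6 / 5 := by
      have h3 : y * m = 250 / 1728 := by
        rw [hy, hm]
        field_simp
        linarith
      have h4 := Real.exp_bound_div_one_sub_of_interval (x := y * m) (by rw [h3]; norm_num)
        (by rw [h3]; norm_num)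
      refine h4.trans ?_
      rw [h3]
      norm_num
    have h5 : ∀ a, 2 * ∫ ω, fewPulls ((i, 0), a) T m ω
          ∂((hardRing γ ε hγ0 hγ1 hε hεγ b₀).law π s) - Real.exp (y * m) ≤
        ∫ ω, fewPulls ((i, 0), Function.update f i a i) T m ω
        ∂((hardRing γ ε hγ0 hγ1 hε hεγ fun j => some (Function.update f i a j)).law π s) := by
      intro a
      rw [Function.update_self]
      refine integral_fewPulls_ge (u := θ) (w := θ + ε) ((i, 0), a) ?_ ?_ ?_ ⟨hθ0, by linarith⟩
        ⟨by linarith, by linarith⟩ ?_ hy0 π s T m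
      · rintro ⟨j, c⟩ a' hne
        simp only [moveProb, b₀]
        by_cases hc : c = 0
        · by_cases hj : j = i
          · subst hj
            have : ¬ a = a' := fun h => hne (by rw [h, hc])
            simp [this]
          · simp [hc, hj]
        · simp [hc]
      · simp [moveProb, b₀, hθ]
      · simp [moveProb, hθ]
      · have h6 : 1 + y ≤ Real.exp y := by linarith [Real.add_one_le_exp y]
        refine le_trans ?_ h6
        have e0 : 0 < θ + ε := by linarith
        have e1 : 0 < 1 - (θ + ε) := by linarith
        have e2 : θ ^ 2 / (θ + ε) + (1 - θ) ^ 2 / (1 - (θ + ε)) =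
            1 + ε ^ 2 / ((θ + ε) * (1 - (θ + ε))) := by
          field_simp
          ring
        rw [e2, hy]
        refine add_le_add_right (div_le_div_of_nonneg_left (sq_nonneg ε) (by positivity) ?_) 1
        rw [mul_comm]
        exact mul_le_mul (by linarith) (by linarith) (by norm_num) e0.le
    have h7 := Finset.sum_le_sum fun a (_ : a ∈ Finset.univ) => h5 a
    rw [Finset.sum_sub_distrib, ← Finset.mul_sum, Finset.sum_const, Finset.card_univ,
      Fintype.card_fin, nsmul_eq_mul] at h7
    nlinarith
  obtain ⟨f, hf⟩ := exists_sum_ge_of_sum_update_ge (fun f i => ∫ ω, fewPulls ((i, 0), f i) T m ω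
        ∂((hardRing γ ε hγ0 hγ1 hε hεγ fun j => some (f j)).law π s)) (2 / 5) hfew
  refine ⟨f, ?_⟩
  rw [Fintype.card_fin] at hf
  set μ := (hardRing γ ε hγ0 hγ1 hε hεγ fun i => some (f i)).law π s with hμ
  have hmin : 17 / 200 * (T : ℝ) ≤
      ∫ ω, ∑ i : Fin S, min (visits (i, 0) T ω) (T / (10 * S)) ∂μ :=
    integral_sum_min_visits_ge hθ0 (hlow _) (hupp _) hup' hT π s
  have iF : ∀ i : Fin S, Integrable (fun ω => fewPulls ((i, 0), f i) T m ω) μ :=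
    fun i => integrable_of_dependsOn (dependsOn_fewPulls _ T m) _
  have iM : ∀ i : Fin S, Integrable (fun ω => min (visits (i, 0) T ω) (T / (10 * S) : ℝ)) μ :=
    fun i => integrable_of_dependsOn (n := T) (fun y z hyz => by
      simp only [dependsOn_visits (i, 0) T hyz]) _
  have iX : ∀ i : Fin S,
      Integrable (fun ω => visits (i, 0) T ω - pulls ((i, 0), f i) T ω) μ :=
    fun i => (integrable_of_dependsOn (dependsOn_visits (i, 0) T) μ).sub
      (integrable_of_dependsOn (dependsOn_pulls ((i, 0), f i) T) μ)
  set K : ℝ := T / (10 * S) with hK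
  have hK0 : 0 < K := by positivity
  -- if the optimal action is pulled at most `m` times, all but `m` of the visits are suboptimal pulls
  have hpt : ∀ (i : Fin S) (ω : ℕ → (Fin S × Fin 2) × Fin A),
      min (visits (i, 0) T ω) K + K * fewPulls ((i, 0), f i) T m ω - (m + K) ≤
        visits (i, 0) T ω - pulls ((i, 0), f i) T ω := by
    intro i ω
    have h1 := min_le_left (visits (i, 0) T ω) K
    have h2 := min_le_right (visits (i, 0) T ω) K
    have h3 := pulls_le_visits ((i, 0), f i) T ω
    rw [fewPulls]
    split_ifs with h <;> linarith
  have hi : ∀ i : Fin S, ∫ ω, min (visits (i, 0) T ω) K ∂μ +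
      K * ∫ ω, fewPulls ((i, 0), f i) T m ω ∂μ - (m + K) ≤
        ∫ ω, (visits (i, 0) T ω - pulls ((i, 0), f i) T ω) ∂μ := by
    intro i
    have iMF : Integrable (fun ω => min (visits (i, 0) T ω) K +
        K * fewPulls ((i, 0), f i) T m ω) μ := (iM i).add ((iF i).const_mul K)
    have h1 := integral_mono (iMF.sub (integrable_const (m + K))) (iX i) fun ω => hpt i ω
    refine le_trans (le_of_eq ?_) h1
    have h2 : ∫ ω, (min (visits (i, 0) T ω) K + K * fewPulls ((i, 0), f i) T m ω - (m + K)) ∂μ =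
        _ := integral_sub iMF (integrable_const (m + K))
    refine Eq.trans ?_ h2.symm
    rw [integral_add (iM i) ((iF i).const_mul K), integral_const_mul]
    simp
  rw [integral_finsetSum _ fun i _ => iM i] at hmin
  rw [integral_finsetSum _ fun i _ => iX i]
  refine le_trans ?_ (Finset.sum_le_sum fun i _ => hi i)
  rw [Finset.sum_sub_distrib, Finset.sum_add_distrib, ← Finset.mul_sum, Finset.sum_const,
    Finset.card_univ, Fintype.card_fin, nsmul_eq_mul]
  have h1 : K * (2 / 5 * S) ≤ K * ∑ i, ∫ ω, fewPulls ((i, 0), f i) T m ω ∂μ :=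
    mul_le_mul_of_nonneg_left hf hK0.le
  have h2 : S * K = T / 10 := by rw [hK]; field_simp
  have h3 : S * m ≤ T / 200 := by
    have : S * m = 5 * T / A := by rw [hm]; field_simp
    rw [this, div_le_div_iff₀ hA0 (by norm_num)]
    nlinarith
  nlinarith

end DiscountedMDP

/-! ### Numerical bounds -/

lemma one_le_logFactor {S T : ℕ} {γ : ℝ} (hS : 1 ≤ S) (hT : 1 ≤ T) (hγ0 : 0 ≤ γ) (hγ1 : γ < 1) :
    1 ≤ logFactor S T γ := by
  have hS' : (1 : ℝ) ≤ S := by exact_mod_cast hS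
  have hT' : (1 : ℝ) ≤ T := by exact_mod_cast hT
  have hθ : 0 < 1 - γ := by linarith
  have hexp : Real.exp 1 ≤ 10 := Real.exp_one_lt_d9.le.trans (by norm_num)
  have hST : (1 : ℝ) ≤ (S : ℝ) ^ 4 * (T : ℝ) ^ 2 :=
    one_le_mul_of_one_le_of_one_le (one_le_pow₀ hS') (one_le_pow₀ hT')
  have h1 : (1 : ℝ) ≤ Real.log (300 * (S : ℝ) ^ 4 * (T : ℝ) ^ 2 / (1 - γ)) := by
    rw [Real.le_log_iff_exp_le (by positivity)]
    refine hexp.trans ?_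
    rw [le_div_iff₀ hθ, mul_assoc]
    linarith
  have h2 : (1 : ℝ) ≤ Real.log (10 * S * T) := by
    rw [Real.le_log_iff_exp_le (by positivity)]
    refine hexp.trans ?_
    have : (1 : ℝ) ≤ S * T := one_le_mul_of_one_le_of_one_le hS' hT'
    linarith
  exact one_le_mul_of_one_le_of_one_le h1 h2

lemma rpow_three_halves {θ : ℝ} (hθ : 0 < θ) : θ ^ (3 / 2 : ℝ) = θ * Real.sqrt θ := by
  rw [Real.sqrt_eq_rpow, show (3 / 2 : ℝ) = 1 + 1 / 2 by norm_num, Real.rpow_add hθ, Real.rpow_one]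

/-- The regret of `T / 50` suboptimal actions beats the leading term of the lower bound. -/
lemma leading_term_le {S A T γ ε : ℝ} (hS : 0 < S) (hA : 0 < A) (hT : 0 < T) (hγ : 2 / 3 ≤ γ)
    (hγ1 : γ < 1) (hε : 0 ≤ ε) (hεθ : ε ≤ (1 - γ) / 10) (hTθ : 10 ^ 7 ≤ (1 - γ) * T)
    (hεA : ε ^ 2 * T * 576 = 10 * S * A * (1 - γ)) :
    Real.sqrt (S * A * T) / (10000 * (1 - γ) ^ (3 / 2 : ℝ)) ≤
      (γ * ε * DiscountedMDP.valueGap γ ε * (T / 50) -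
        γ * ε * DiscountedMDP.valueGap γ ε / (1 - γ)) / (1 - γ) := by
  have hθ : 0 < 1 - γ := by linarith
  rw [rpow_three_halves hθ]
  set θ := 1 - γ with hθdef
  set D := γ * ε * DiscountedMDP.valueGap γ ε with hD
  have hDlow : ε / (5 * θ) ≤ D := by
    rw [hD, DiscountedMDP.valueGap, ← hθdef, mul_one_div, div_le_div_iff₀ (by positivity)
      (by positivity)]
    have h1 : θ + 2 * γ * θ + γ * ε ≤ 31 / 10 * θ := by nlinarith
    nlinarith [mul_le_mul_of_nonneg_left h1 hε, mul_nonneg hε hθ.le]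
  have hD0 : 0 ≤ D := le_trans (by positivity) hDlow
  set R := Real.sqrt (S * A * T * θ) with hR
  have hR' : R = Real.sqrt (S * A * T) * Real.sqrt θ := Real.sqrt_mul (by positivity) θ
  have hRε : R ≤ 8 * (ε * T) := by
    rw [hR]
    refine Real.sqrt_le_iff.2 ⟨by positivity, ?_⟩
    have : (ε * T) ^ 2 * 576 = 10 * (S * A * T * θ) := by linear_combination T * hεA
    nlinarith [mul_nonneg (mul_nonneg (mul_nonneg hS.le hA.le) hT.le) hθ.le]
  have h1 : D / θ ≤ D * (T / 10 ^ 7) := by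
    rw [div_eq_mul_inv]
    refine mul_le_mul_of_nonneg_left ?_ hD0
    rw [inv_le_iff_one_le_mul₀ hθ]
    linarith
  have h2 : ε / (5 * θ) * (T / 60) ≤ D * (T / 50) - D / θ := by
    have h3 : ε / (5 * θ) * (T / 60) ≤ D * (T / 60) :=
      mul_le_mul_of_nonneg_right hDlow (by positivity)
    have h4 : 0 ≤ D * T := by positivity
    linarith
  have h5 : Real.sqrt (S * A * T) / (10000 * (θ * Real.sqrt θ)) = R / (10000 * θ ^ 2) := by
    have hs : 0 < Real.sqrt θ := Real.sqrt_pos.2 hθ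
    rw [hR', div_eq_div_iff (by positivity) (by positivity)]
    linear_combination (-(Real.sqrt (S * A * T) * 10000 * θ)) * Real.mul_self_sqrt hθ.le
  rw [h5]
  calc R / (10000 * θ ^ 2) ≤ 8 * (ε * T) / (10000 * θ ^ 2) := by gcongr
    _ ≤ ε / (5 * θ) * (T / 60) / θ := by
        rw [show ε / (5 * θ) * (T / 60) / θ = ε * T / (300 * θ ^ 2) by
          field_simp; ring,
          div_le_div_iff₀ (by positivity) (by positivity)]
        have : 0 ≤ ε * T * θ ^ 2 := by positivity
        nlinarith
    _ ≤ _ := div_le_div_of_nonneg_right h2 hθ.le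

end

open DiscountedMDP

theorem theorem2 (S A T : ℕ) [NeZero S] (γ : ℝ) (hγ : 2 / 3 ≤ γ) (hγ1 : γ < 1)
    (hA : 30 ≤ A) (hT1 : 1 ≤ T)
    (hT : 100 * (S : ℝ) * (A : ℝ) * logFactor S T γ / (1 - γ) ^ 4 ≤ (T : ℝ))
    (π : Policy (Fin S × Fin 2) (Fin A)) (s₁ : Fin S × Fin 2) :
    ∃ (aStar : Fin S → Fin A) (M : DiscountedMDP (Fin S × Fin 2) (Fin A)),
      M.IsHardRing γ (Real.sqrt ((A : ℝ) * (1 - γ) / ((T : ℝ) / (10 * (S : ℝ)))) / 24) aStar ∧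
      Real.sqrt ((S : ℝ) * A * T) / (10000 * (1 - γ) ^ (3 / 2 : ℝ))
          - 4 * Real.sqrt ((S : ℝ) * T * logFactor S T γ) / (1 - γ) ^ (3 / 2 : ℝ)
          - 8 * (S : ℝ) / (1 - γ) ^ 2
        ≤ M.expectedRegret π s₁ T := by
  have hγ0 : 0 < γ := by linarith
  have hS1 : 1 ≤ S := Nat.pos_of_neZero S
  have hS : (0 : ℝ) < S := by exact_mod_cast hS1
  have hA0 : (0 : ℝ) < A := by exact_mod_cast (by omega : 0 < A)
  have hT0 : (0 : ℝ) < T := by exact_mod_cast hT1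
  have hL : 1 ≤ logFactor S T γ := one_le_logFactor hS1 hT1 hγ0.le hγ1
  set L := logFactor S T γ
  set ε := Real.sqrt ((A : ℝ) * (1 - γ) / ((T : ℝ) / (10 * (S : ℝ)))) / 24 with hεdef
  have hθ : 0 < 1 - γ := by linarith
  have hθ3 : 1 - γ ≤ 1 / 3 := by linarith
  have hε : 0 ≤ ε := by positivity
  have hεA : ε ^ 2 * T * 576 = 10 * S * A * (1 - γ) := by
    rw [hεdef, div_pow, Real.sq_sqrt (by positivity)]
    field_simp
    norm_num
  have hTθ : 100 * S * A * L ≤ T * (1 - γ) ^ 4 := by rwa [div_le_iff₀ (by positivity)] at hT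
  have hθ4 : (1 - γ) ^ 4 ≤ (1 - γ) := pow_le_of_le_one hθ.le (by linarith) (by norm_num)
  have hSA : 0 < (S : ℝ) * A := by positivity
  have hSAL : (S : ℝ) * A ≤ S * A * L := le_mul_of_one_le_right hSA.le hL
  have hεθ : ε ≤ (1 - γ) / 10 := by
    refine le_of_sq_le_sq ?_ (by positivity)
    have h1 : 100 * (S * A) ≤ T * (1 - γ) ^ 4 := by linarith
    have h2 : (1 - γ) ^ 3 ≤ 1 := pow_le_one₀ hθ.le (by linarith)
    have h3 : T * (1 - γ) ^ 4 ≤ T * (1 - γ) := mul_le_mul_of_nonneg_left hθ4 hT0.le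
    have h4 : ε ^ 2 * T * 576 ≤ T * (1 - γ) * (1 - γ) / 10 := by
      rw [hεA]
      nlinarith
    nlinarith
  have hεγ : ε ≤ γ := by linarith
  by_cases hAL : (A : ℝ) ≤ 40000 ^ 2 * L
  · -- for small `A` the right-hand side of the claim is at most `0`
    let f : Fin S → Fin A := fun _ => ⟨0, by omega⟩
    refine ⟨f, hardRing γ ε hγ0 hγ1 hε hεγ fun i => some (f i), isHardRing_hardRing f, ?_⟩
    refine le_trans ?_ (expectedRegret_nonneg (hasGap_hardRing f) (ringGap_nonneg hγ0 hγ1 hε f)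
      (f := fun x => f x.1) (ringGap_optimal f) π s₁ T)
    have h1 : Real.sqrt ((S : ℝ) * A * T) ≤ 40000 * Real.sqrt (S * T * L) := by
      rw [← Real.sqrt_sq (by norm_num : (0 : ℝ) ≤ 40000), ← Real.sqrt_mul (by positivity)]
      refine Real.sqrt_le_sqrt ?_
      nlinarith [mul_le_mul_of_nonneg_left hAL (mul_nonneg hS.le hT0.le)]
    have h2 : Real.sqrt ((S : ℝ) * A * T) / (10000 * (1 - γ) ^ (3 / 2 : ℝ)) ≤
        4 * Real.sqrt (S * T * L) / (1 - γ) ^ (3 / 2 : ℝ) := by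
      rw [div_le_div_iff₀ (by positivity) (by positivity)]
      have : 0 < (1 - γ) ^ (3 / 2 : ℝ) := by positivity
      nlinarith
    have h3 : 0 ≤ 8 * (S : ℝ) / (1 - γ) ^ 2 := by positivity
    linarith
  · have hAbig : (40000 ^ 2 : ℝ) < A := by nlinarith
    have hA1000 : 1000 ≤ A := by
      have : (1000 : ℝ) ≤ A := by linarith
      exact_mod_cast this
    have hTS : (10 : ℝ) ^ 7 * S ≤ (1 - γ) * T := by nlinarith
    obtain ⟨f, hf⟩ := exists_suboptimal_ge rfl hγ hγ0 hγ1 hε hεγ hεθ hTS hA1000 hεA π s₁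
    refine ⟨f, hardRing γ ε hγ0 hγ1 hε hεγ fun i => some (f i), isHardRing_hardRing f, ?_⟩
    have hreg := expectedRegret_ge (M := hardRing γ ε hγ0 hγ1 hε hεγ fun i => some (f i))
      (hasGap_hardRing f) (ringGap_nonneg hγ0 hγ1 hε f) (ringGap_le hγ0 hγ1 hε f) (f := fun x => f x.1) (ringGap_optimal f) π s₁ T
    refine le_trans ?_ hreg
    have hdisc : (hardRing γ ε hγ0 hγ1 hε hεγ fun i => some (f i)).discount = γ := rfl
    rw [hdisc, ← integral_finsetSum _ fun t _ => integrable_eval _ (ringGap γ ε f) t]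
    simp only [sum_ringGap]
    rw [integral_const_mul]
    have hS1' : (1 : ℝ) ≤ S := by exact_mod_cast hS1
    have hlead := leading_term_le hS hA0 hT0 hγ hγ1 hε hεθ (by linarith) hεA
    have hD0 : 0 ≤ γ * ε * valueGap γ ε := by
      have := valueGap_pos hγ0 hγ1 hε
      positivity
    have h1 : 0 ≤ 4 * Real.sqrt ((S : ℝ) * T * L) / (1 - γ) ^ (3 / 2 : ℝ) := by positivity
    have h2 : 0 ≤ 8 * (S : ℝ) / (1 - γ) ^ 2 := by positivity
    refine le_trans (by linarith) (hlead.trans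
      (div_le_div_of_nonneg_right (sub_le_sub_right ?_ _) hθ.le))
    exact mul_le_mul_of_nonneg_left hf hD0
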